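/- Let $p\ge 5$ be a prime and let $R_p=\widehat{\mathbb Z}_p^{ur}=W(\overline{\mathbb F}_p)$ be the completion of the maximal unramified extension of $\mathbb Z_p$, with its Frobenius lift $\phi$. Let $\pi$ be a root of an Eisenstein polynomial of degree $e\ge 2$ over $\mathbb Z_p$, let $R_\pi=R_p[\pi]=R_p\otimes_{\mathbb Z_p}\mathbb Z_p[\pi]$, extend $\phi$ to $R_\pi$ by $\phi(\pi)=\pi$, and let $v_p$ be the valuation on $R_\pi$ with $v_p(p)=1$. Write $\hat{\ }$ for $p$-adic completion. A $p$-derivation from a ring $A$ to an $A$-algebra $B$ is a map $\delta_p:A\to B$ with $\delta_p(1)=0$, $\delta_p(x+y)=\delta_px+\delta_py+\frac{x^p+y^p-(x+y)^p}{p}$ and $\delta_p(xy)=x^p\delta_py+y^p\delta_px+p\,\delta_px\,\delta_py$; then $\phi(x)=x^p+p\,\delta_px$ is a ring homomorphism. A $\delta_p$-prolongation sequence is a sequence of rings $A^0\to A^1\to\cdots$ with compatible $p$-derivations $\delta_p:A^n\to A^{n+1}$. Replacing $p$ by $\pi$ as the denominator, one defines $\pi$-derivations $\delta_\pi$ (with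 $\phi(x)=x^p+\pi\,\delta_\pi x$) and $\delta_\pi$-prolongation sequences. These sequences are taken over $R_p$, respectively $R_\pi$, equipped with $\delta_px=(\phi(x)-x^p)/p$, respectively $\delta_\pi x=(\phi(x)-x^p)/\pi$. Let $X=\mathrm{Spec}\,S$ be a smooth affine $R_p$-scheme and $r\ge 1$. Let $S^r_p=\mathcal O(J^r_p(X))$ be the $p$-adic completion of the $r$-th term of the universal $\delta_p$-prolongation sequence starting with $S$, and let $S^r_\pi=\mathcal O(J^r_\pi(X_{R_\pi}))$ be the $p$-adic completion of the $r$-th term of the universal $\delta_\pi$-prolongation sequence starting with $S\otimes_{R_p}R_\pi$. On $S^*_p\otimes_{R_p}R_\pi$ put $\phi=\phi\otimes\phi$ and $\delta_\pi z=(\phi(z)-z^p)/\pi$; universality gives a canonical homomorphism $S^r_\pi\to S^r_p\otimes_{R_p}R_\pi$. For a tuple of variables ${\bf T}$, consider the polynomial rings $R_\pi[{\bf T},\delta_p{\bf T},\dots,\delta_p^i{\bf T}]$ with $\phi(\delta_p^i{\bf T})=(\delta_p^i{\bf T})^p+p\,\delta_p^{i+1}{\bf T}$ and $\delta_\pi f=(\phi(f)-f^p)/\pi$.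 Sending the variable $\delta_\pi^i{\bf T}$ to the polynomial $\{\delta_\pi^i{\bf T}\}_{|{\bf T}=0}$ in $\delta_p{\bf T},\dots,\delta_p^i{\bf T}$ gives, together with the canonical homomorphism on coefficients, the natural homomorphism $$(\ast)\qquad S^r_\pi[\delta_\pi{\bf T},\dots,\delta_\pi^r{\bf T}]\hat{\ }\longrightarrow (S^r_p\otimes_{R_p}R_\pi)[\delta_p{\bf T},\dots,\delta_p^r{\bf T}]\hat{\ }.$$ Let $\mathcal F\in S[[T_1,T_2]]$ be a one-dimensional formal group law over $S$ and let $l(T)=\sum_{n\ge1}a_nT^n\in(S\otimes\mathbb Q)[[T]]$ be its logarithm. With respect to the natural $\delta_p$-prolongation sequences $(S^r_p[[{\bf T},\delta_p{\bf T},\dots,\delta_p^r{\bf T}]])_{r\ge0}$, where ${\bf T}=(T_1,T_2)$, respectively ${\bf T}=T$, set $$F_r:=\{\delta_p^r\mathcal F\}_{|{\bf T}=0},\qquad L^r_p:=\tfrac1p\{\phi^r(l(T))\}_{|T=0}\in(S^r_p\otimes\mathbb Q)[[\delta_pT,\dots,\delta_p^rT]].$$ Then: 1) For some integer $n(r)\ge1$,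 $p^{n(r)}F_r$ belongs to the image of $(\ast)$ for ${\bf T}=(T_1,T_2)$. 2) If $v_p(\pi)\ge\frac1{p-1}$, then $L^r_\pi:=\frac p\pi L^r_p$ belongs to the image of $(\ast)$ for the single variable ${\bf T}=T$. -/

import Mathlib

noncomputable section

namespace PiJet

open scoped TensorProduct

universe u v

/-! ## Polynomial rings with a Fermat quotient operator -/

/-- A domain `R` with an element `ϖ ≠ 0` dividing `p` and an endomorphism `φ` fixing `ϖ` and
lifting the `p`-power Frobenius of `R / ϖ`. Two instances are built below: `(R_p, p)` and
`(R_π, π)`. -/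
structure FrobBase (p : ℕ) (R : Type*) [CommRing R] where
  ϖ : R
  ϖ_ne_zero : ϖ ≠ 0
  dvd_p : ϖ ∣ (p : R)
  φ : R →+* R
  φ_ϖ : φ ϖ = ϖ
  dvd_frob : ∀ x, ϖ ∣ φ x - x ^ p

section Polynomials

variable {p : ℕ} {R : Type*} [CommRing R] (B : FrobBase p R) {ι : Type*}

/-- In `MvPolynomial (ι × ℕ) R` the variable `(a, i)` plays the role of the `i`-th derivative
`δ^i x_a` of the variable `x_a = (a, 0)`. This is the `φ`-semilinear ring endomorphism with
`δ^i x_a ↦ (δ^i x_a)^p + c · δ^(i+1) x_a`. -/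
def Phi (c : R) : MvPolynomial (ι × ℕ) R →+* MvPolynomial (ι × ℕ) R :=
  MvPolynomial.eval₂Hom (MvPolynomial.C.comp B.φ)
    (fun s => MvPolynomial.X s ^ p + MvPolynomial.C c * MvPolynomial.X (s.1, s.2 + 1))

open Classical in
/-- The `ϖ`-derivation `f ↦ (Φ(f) - f^p) / ϖ` on `MvPolynomial (ι × ℕ) R` attached to `Phi B c`;
for `ϖ ∣ c` the division is always possible, and unique, see `delta_spec`. -/
def delta (c : R) (f : MvPolynomial (ι × ℕ) R) : MvPolynomial (ι × ℕ) R :=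
  if h : ∃ g, MvPolynomial.C B.ϖ * g = Phi B c f - f ^ p then h.choose else 0

theorem exists_delta [Fact p.Prime] {c : R} (hc : B.ϖ ∣ c) (f : MvPolynomial (ι × ℕ) R) :
    ∃ g, MvPolynomial.C B.ϖ * g = Phi B c f - f ^ p := by
  suffices h : MvPolynomial.C B.ϖ ∣ Phi B c f - f ^ p by
    obtain ⟨g, hg⟩ := h
    exact ⟨g, hg.symm⟩
  have hp0 : (MvPolynomial.C B.ϖ : MvPolynomial (ι × ℕ) R) ∣ (p : MvPolynomial (ι × ℕ) R) := by
    have := map_dvd (MvPolynomial.C (σ := ι × ℕ)) B.dvd_p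
    simpa using this
  induction f using MvPolynomial.induction_on with
  | C a =>
    have := map_dvd (MvPolynomial.C (σ := ι × ℕ)) (B.dvd_frob a)
    simpa [Phi] using this
  | add f g hf hg =>
    obtain ⟨r, hr⟩ := exists_add_pow_prime_eq (Fact.out : p.Prime) f g
    rw [hr, map_add]
    have : Phi B c f + Phi B c g - (f ^ p + g ^ p + p * f * g * r)
        = (Phi B c f - f ^ p) + (Phi B c g - g ^ p) - p * (f * g * r) := by ring
    rw [this]
    exact dvd_sub (dvd_add hf hg) (Dvd.dvd.mul_right hp0 _)
  | mul_X f s hf =>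
    have hX : Phi B c (MvPolynomial.X s)
        = MvPolynomial.X s ^ p + MvPolynomial.C c * MvPolynomial.X (s.1, s.2 + 1) := by
      simp [Phi]
    rw [map_mul, hX]
    have : Phi B c f * (MvPolynomial.X s ^ p + MvPolynomial.C c * MvPolynomial.X (s.1, s.2 + 1))
        - (f * MvPolynomial.X s) ^ p = (Phi B c f - f ^ p) * MvPolynomial.X s ^ p
          + MvPolynomial.C c * (Phi B c f * MvPolynomial.X (s.1, s.2 + 1)) := by
      rw [mul_pow]; ring
    rw [this]
    exact dvd_add (Dvd.dvd.mul_right hf _)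
      (Dvd.dvd.mul_right (map_dvd (MvPolynomial.C (σ := ι × ℕ)) hc) _)

theorem delta_spec [Fact p.Prime] {c : R} (hc : B.ϖ ∣ c) (f : MvPolynomial (ι × ℕ) R) :
    MvPolynomial.C B.ϖ * delta B c f = Phi B c f - f ^ p := by
  have h := exists_delta B hc f
  rw [delta, dif_pos h]
  exact h.choose_spec

theorem Phi_eq [Fact p.Prime] {c : R} (hc : B.ϖ ∣ c) (f : MvPolynomial (ι × ℕ) R) :
    Phi B c f = f ^ p + MvPolynomial.C B.ϖ * delta B c f := by
  rw [delta_spec B hc]; ring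

theorem C_mul_cancel [IsDomain R] {x y : MvPolynomial (ι × ℕ) R}
    (h : MvPolynomial.C B.ϖ * x = MvPolynomial.C B.ϖ * y) : x = y :=
  mul_left_cancel₀ (by simpa using B.ϖ_ne_zero) h

theorem delta_add [Fact p.Prime] [IsDomain R] {c : R} (hc : B.ϖ ∣ c)
    (f g : MvPolynomial (ι × ℕ) R) :
    ∃ r, delta B c (f + g) = delta B c f + delta B c g + f * r := by
  obtain ⟨r, hr⟩ := exists_add_pow_prime_eq (Fact.out : p.Prime) f g
  obtain ⟨q, hq⟩ := B.dvd_p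
  refine ⟨- (MvPolynomial.C q * g * r), C_mul_cancel B ?_⟩
  have hq' : (p : MvPolynomial (ι × ℕ) R) = MvPolynomial.C B.ϖ * MvPolynomial.C q := by
    rw [← map_mul, ← hq, map_natCast]
  rw [mul_add, mul_add, delta_spec B hc, delta_spec B hc, delta_spec B hc, hr, map_add, hq']
  ring

theorem delta_mul [Fact p.Prime] [IsDomain R] {c : R} (hc : B.ϖ ∣ c)
    (f g : MvPolynomial (ι × ℕ) R) :
    delta B c (f * g) = Phi B c f * delta B c g + delta B c f * g ^ p := by
  refine C_mul_cancel B ?_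
  have h1 := delta_spec B hc f
  have h2 := delta_spec B hc g
  rw [delta_spec B hc, map_mul, mul_add, mul_left_comm, h2, ← mul_assoc, h1]
  ring

/-- `delta` maps the ideal generated by `G` into any ideal that contains `G` and `delta G`. -/
theorem delta_mem [Fact p.Prime] [IsDomain R] {c : R} (hc : B.ϖ ∣ c)
    {G : Set (MvPolynomial (ι × ℕ) R)} {K : Ideal (MvPolynomial (ι × ℕ) R)}
    (hG : ∀ g ∈ G, g ∈ K) (hG' : ∀ g ∈ G, delta B c g ∈ K)
    {x : MvPolynomial (ι × ℕ) R} (hx : x ∈ Ideal.span G) : delta B c x ∈ K := by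
  have hp := (Fact.out : p.Prime).ne_zero
  have hsp : Ideal.span G ≤ K := Ideal.span_le.2 hG
  induction hx using Submodule.span_induction with
  | mem x h => exact hG' x h
  | zero =>
    have : delta B c (0 : MvPolynomial (ι × ℕ) R) = 0 :=
      C_mul_cancel B (by rw [delta_spec B hc]; simp [hp])
    rw [this]; exact K.zero_mem
  | add x y hx _ ihx ihy =>
    obtain ⟨r, hr⟩ := delta_add B hc x y
    rw [hr]
    exact K.add_mem (K.add_mem ihx ihy) (K.mul_mem_right _ (hsp hx))
  | smul a x hx ih =>
    rw [smul_eq_mul, delta_mul B hc]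
    exact K.add_mem (K.mul_mem_left _ ih)
      (K.mul_mem_left _ (K.pow_mem_of_mem (hsp hx) p (Nat.pos_of_ne_zero hp)))

/-- A ring endomorphism that intertwines `Phi` and fixes `ϖ` intertwines `delta`. -/
theorem delta_comm [Fact p.Prime] {R' : Type*} [CommRing R'] [IsDomain R'] {ι' : Type*}
    (B' : FrobBase p R') {c : R} {c' : R'} (hc : B.ϖ ∣ c) (hc' : B'.ϖ ∣ c')
    (θ : MvPolynomial (ι × ℕ) R →+* MvPolynomial (ι' × ℕ) R')
    (hθϖ : θ (MvPolynomial.C B.ϖ) = MvPolynomial.C B'.ϖ)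
    (hθ : ∀ f, θ (Phi B c f) = Phi B' c' (θ f)) (f : MvPolynomial (ι × ℕ) R) :
    θ (delta B c f) = delta B' c' (θ f) := by
  refine C_mul_cancel B' ?_
  rw [delta_spec B' hc', ← hθϖ, ← map_mul, delta_spec B hc, map_sub, map_pow, hθ]

theorem delta_X [Fact p.Prime] [IsDomain R] {c q : R} (hc : c = B.ϖ * q) (s : ι × ℕ) :
    delta B c (MvPolynomial.X s) = MvPolynomial.C q * MvPolynomial.X (s.1, s.2 + 1) := by
  refine C_mul_cancel B ?_
  rw [delta_spec B ⟨q, hc⟩, ← mul_assoc, ← map_mul, ← hc]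
  simp [Phi]

/-- `δ^i x_a` has no constant term. -/
theorem constantCoeff_delta_iterate [Fact p.Prime] [IsDomain R] {c : R} (hc : B.ϖ ∣ c)
    (s : ι × ℕ) (i : ℕ) :
    MvPolynomial.constantCoeff ((delta B c)^[i] (MvPolynomial.X s)) = 0 := by
  obtain ⟨q, hq⟩ := hc
  set K : Ideal (MvPolynomial (ι × ℕ) R) := Ideal.span (Set.range MvPolynomial.X) with hK
  have key : (delta B c)^[i] (MvPolynomial.X s) ∈ K := by
    induction i with
    | zero => exact Ideal.subset_span ⟨s, rfl⟩
    | succ i ih =>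
      rw [Function.iterate_succ_apply']
      refine delta_mem B ⟨q, hq⟩ (fun g hg => Ideal.subset_span hg) ?_ ih
      rintro _ ⟨t, rfl⟩
      rw [delta_X B hq]
      exact K.mul_mem_left _ (Ideal.subset_span ⟨_, rfl⟩)
  have hle : K ≤ RingHom.ker (MvPolynomial.constantCoeff (σ := ι × ℕ) (R := R)) := by
    rw [hK, Ideal.span_le]
    rintro _ ⟨t, rfl⟩
    simp [RingHom.mem_ker]
  exact hle key

/-- The ideal of multiples of the derivatives of order `≤ i` of `h`. -/
def derivIdeal (c : R) (h : MvPolynomial (ι × ℕ) R) (i : ℕ) : Ideal (MvPolynomial (ι × ℕ) R) :=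
  Ideal.span {g | ∃ j ≤ i, g = (delta B c)^[j] h}

theorem Phi_iterate_mem [Fact p.Prime] [IsDomain R] {c : R} (hc : B.ϖ ∣ c)
    (h : MvPolynomial (ι × ℕ) R) (i : ℕ) : (Phi B c)^[i] h ∈ derivIdeal B c h i := by
  induction i with
  | zero => exact Ideal.subset_span ⟨0, le_rfl, rfl⟩
  | succ i ih =>
    rw [Function.iterate_succ_apply', Phi_eq B hc]
    have hmono : derivIdeal B c h i ≤ derivIdeal B c h (i + 1) :=
      Ideal.span_mono fun g ⟨j, hj, hg⟩ => ⟨j, by omega, hg⟩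
    refine Ideal.add_mem _ (Ideal.pow_mem_of_mem _ (hmono ih) p (Fact.out : p.Prime).pos)
      (Ideal.mul_mem_left _ _ (delta_mem B hc (fun g hg => hmono (Ideal.subset_span hg)) ?_ ih))
    rintro _ ⟨j, hj, rfl⟩
    exact Ideal.subset_span ⟨j + 1, by omega, (Function.iterate_succ_apply' _ _ _).symm⟩

/-- `delta` raises the order by at most one. -/
theorem delta_supported [Fact p.Prime] [IsDomain R] {c : R} (hc : B.ϖ ∣ c) (n : ℕ)
    {f : MvPolynomial (ι × ℕ) R} (hf : f ∈ MvPolynomial.supported R {s : ι × ℕ | s.2 ≤ n}) :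
    delta B c f ∈ MvPolynomial.supported R {s : ι × ℕ | s.2 ≤ n + 1} := by
  classical
  set V := MvPolynomial.supported R {s : ι × ℕ | s.2 ≤ n + 1} with hV
  have hmono : MvPolynomial.supported R {s : ι × ℕ | s.2 ≤ n} ≤ V :=
    MvPolynomial.supported_mono fun s (hs : s.2 ≤ n) => (by simp; omega)
  have hPhi : Phi B c f ∈ V := by
    rw [MvPolynomial.supported] at hf
    induction hf using Algebra.adjoin_induction with
    | mem x hx =>
      obtain ⟨s, hs, rfl⟩ := hx
      simp only [Set.mem_ofPred_eq] at hs
      have h1 : (MvPolynomial.X s : MvPolynomial (ι × ℕ) R) ∈ V :=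
        Algebra.subset_adjoin ⟨s, by simp; omega, rfl⟩
      have h2 : (MvPolynomial.X (s.1, s.2 + 1) : MvPolynomial (ι × ℕ) R) ∈ V :=
        Algebra.subset_adjoin ⟨_, by simp; omega, rfl⟩
      simp only [Phi, MvPolynomial.eval₂Hom_X']
      exact V.add_mem (V.pow_mem h1 p) (V.mul_mem (V.algebraMap_mem c) h2)
    | algebraMap r =>
      simp only [Phi, MvPolynomial.algebraMap_eq, MvPolynomial.eval₂Hom_C, RingHom.comp_apply]
      exact V.algebraMap_mem _
    | add x y _ _ hx hy => rw [map_add]; exact V.add_mem hx hy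
    | mul x y _ _ hx hy => rw [map_mul]; exact V.mul_mem hx hy
  let k : MvPolynomial (ι × ℕ) R →ₐ[R] MvPolynomial (ι × ℕ) R :=
    MvPolynomial.aeval fun s => if s.2 ≤ n + 1 then MvPolynomial.X s else 0
  have hkV : ∀ x ∈ V, k x = x := by
    intro x hx
    rw [hV, MvPolynomial.supported] at hx
    induction hx using Algebra.adjoin_induction with
    | mem x hx =>
      obtain ⟨s, hs, rfl⟩ := hx
      simp only [Set.mem_ofPred_eq] at hs
      simp [k, hs]
    | algebraMap r => exact k.commutes r
    | add x y _ _ hx hy => rw [map_add, hx, hy]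
    | mul x y _ _ hx hy => rw [map_mul, hx, hy]
  have hkr : ∀ x, k x ∈ V := by
    intro x
    induction x using MvPolynomial.induction_on with
    | C a => rw [← MvPolynomial.algebraMap_eq, k.commutes]; exact V.algebraMap_mem a
    | add f g hf hg => rw [map_add]; exact V.add_mem hf hg
    | mul_X f s hf =>
      rw [map_mul]
      refine V.mul_mem hf ?_
      simp only [k, MvPolynomial.aeval_X]
      split_ifs with h
      · exact Algebra.subset_adjoin ⟨s, h, rfl⟩
      · exact V.zero_mem
  have : k (delta B c f) = delta B c f := by
    refine C_mul_cancel B ?_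
    have h1 : k (MvPolynomial.C B.ϖ * delta B c f) = MvPolynomial.C B.ϖ * k (delta B c f) := by
      rw [map_mul, ← MvPolynomial.algebraMap_eq, k.commutes]
    rw [← h1, delta_spec B hc]
    exact hkV _ (V.sub_mem hPhi (V.pow_mem (hmono hf) p))
  rw [← this]
  exact hkr _

theorem delta_iterate_supported [Fact p.Prime] [IsDomain R] {c : R} (hc : B.ϖ ∣ c)
    {f : MvPolynomial (ι × ℕ) R} (hf : f ∈ MvPolynomial.supported R {s : ι × ℕ | s.2 ≤ 0})
    (i : ℕ) : (delta B c)^[i] f ∈ MvPolynomial.supported R {s : ι × ℕ | s.2 ≤ i} := by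
  induction i with
  | zero => exact hf
  | succ i ih => rw [Function.iterate_succ_apply']; exact delta_supported B hc i ih

/-- The inclusion `R[x_a] ⊂ R[x_a, δ x_a, δ² x_a, …]`. -/
def emb : MvPolynomial ι R →ₐ[R] MvPolynomial (ι × ℕ) R :=
  MvPolynomial.rename fun a => (a, 0)

theorem emb_supported (f : MvPolynomial ι R) :
    emb f ∈ MvPolynomial.supported R {s : ι × ℕ | s.2 ≤ 0} := by
  rw [emb, MvPolynomial.supported_eq_range_rename]
  refine ⟨MvPolynomial.rename (fun a => ⟨(a, 0), by simp⟩) f, ?_⟩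
  rw [AlgHom.toRingHom_eq_coe, RingHom.coe_coe, MvPolynomial.rename_rename]
  rfl

/-- The retraction `R[x_a, δ x_a, …] → R[x_a, …, δ^n x_a]`; it is only used on polynomials of
order `≤ n`, which it merely reinterprets. -/
def truncOrder (n : ℕ) :
    MvPolynomial (ι × ℕ) R →ₐ[R] MvPolynomial (ι × Fin (n + 1)) R :=
  MvPolynomial.aeval fun s => if h : s.2 < n + 1 then MvPolynomial.X (s.1, ⟨s.2, h⟩) else 0

/-- For a set `G` of polynomials in variables `x_a`, the ideal
`(δ^i g : g ∈ G, i ≤ n)` of `R[x_a, …, δ^n x_a]`. -/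
def jetIdeal (G : Set (MvPolynomial ι R)) (n : ℕ) : Ideal (MvPolynomial (ι × Fin (n + 1)) R) :=
  Ideal.span {h | ∃ g ∈ G, ∃ i ≤ n, h = truncOrder n ((delta B B.ϖ)^[i] (emb g))}

/-- The `n`-th ring `R[x, δx, …, δ^n x] / (g, δg, …, δ^n g : g ∈ G)` of the universal
prolongation sequence of the `R`-algebra `R[x] / (G)` (before completion). -/
abbrev JetRing (G : Set (MvPolynomial ι R)) (n : ℕ) : Type _ :=
  MvPolynomial (ι × Fin (n + 1)) R ⧸ jetIdeal B G n

/-- The projection `R[x, δx, …] → JetRing B G n`, for polynomials of order `≤ n`. -/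
def toJet (G : Set (MvPolynomial ι R)) (n : ℕ) : MvPolynomial (ι × ℕ) R →ₐ[R] JetRing B G n :=
  (Ideal.Quotient.mkₐ R (jetIdeal B G n)).comp (truncOrder n)

theorem toJet_delta {G : Set (MvPolynomial ι R)} {g : MvPolynomial ι R} (hg : g ∈ G)
    {i n : ℕ} (hi : i ≤ n) : toJet B G n ((delta B B.ϖ)^[i] (emb g)) = 0 :=
  Ideal.Quotient.eq_zero_iff_mem.2 (Ideal.subset_span ⟨g, hg, i, hi, rfl⟩)

end Polynomials

/-! ## The rings `R_p` and `R_π` -/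

section Base

variable (p : ℕ) [Fact p.Prime]

/-- `R_p`, the completion of the maximal unramified extension of `ℤ_p`, i.e. the ring of Witt
vectors of an algebraic closure of `𝔽_p`. -/
abbrev Rp : Type := WittVector p (AlgebraicClosure (ZMod p))

/-- The inclusion `ℤ_p = W(𝔽_p) → R_p`. -/
def fromZp : ℤ_[p] →+* Rp p :=
  (WittVector.map (algebraMap (ZMod p) (AlgebraicClosure (ZMod p)))).comp
    (WittVector.equiv p).symm.toRingHom

/-- `R_p` with uniformizer `p` and the Frobenius lift `φ`. -/
def baseP : FrobBase p (Rp p) where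
  ϖ := p
  ϖ_ne_zero := WittVector.p_nonzero p _
  dvd_p := dvd_rfl
  φ := WittVector.frobenius
  φ_ϖ := map_natCast _ _
  dvd_frob x := by
    rw [← Ideal.mem_span_singleton, WittVector.mem_span_p_iff_coeff_zero_eq_zero,
      ← WittVector.constantCoeff_apply, map_sub, map_pow, WittVector.constantCoeff_apply,
      WittVector.constantCoeff_apply, WittVector.coeff_frobenius_charP, sub_self]

/-- An Eisenstein polynomial of degree `e ≥ 2` over `ℤ_p`. -/
structure EisensteinPoly where
  poly : Polynomial ℤ_[p]
  monic : poly.Monic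
  eisenstein : poly.IsEisensteinAt (Ideal.span {(p : ℤ_[p])})
  two_le : 2 ≤ poly.natDegree

variable {p} (P : EisensteinPoly p)

/-- The Eisenstein polynomial, viewed over `R_p`. -/
def EisensteinPoly.polyR : Polynomial (Rp p) := P.poly.map (fromZp p)

theorem EisensteinPoly.polyR_monic : P.polyR.Monic := P.monic.map _

theorem fromZp_dvd {x : ℤ_[p]} (h : (p : Rp p) ∣ fromZp p x) : (p : ℤ_[p]) ∣ x := by
  rw [← Ideal.mem_span_singleton, WittVector.mem_span_p_iff_coeff_zero_eq_zero] at h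
  have h0 : ((WittVector.equiv p).symm x).coeff 0 = 0 := by
    simpa [fromZp, WittVector.map_coeff] using h
  have h1 : (WittVector.equiv p).symm x ∈ Ideal.span {(p : WittVector p (ZMod p))} :=
    (WittVector.mem_span_p_iff_coeff_zero_eq_zero _).2 h0
  obtain ⟨y, hy⟩ := Ideal.mem_span_singleton.1 h1
  refine ⟨WittVector.equiv p y, ?_⟩
  have := congrArg (WittVector.equiv p) hy
  simpa using this

theorem frobenius_fromZp (x : ℤ_[p]) : WittVector.frobenius (fromZp p x) = fromZp p x := by
  ext n
  have h := congrArg (fun w => w.coeff n)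
    (WittVector.frobenius_zmodp (p := p) ((WittVector.equiv p).symm x))
  simp only [WittVector.coeff_frobenius_charP] at h
  simp only [WittVector.coeff_frobenius_charP, fromZp, RingHom.comp_apply, WittVector.map_coeff]
  rw [← map_pow]
  exact congrArg _ h

theorem EisensteinPoly.polyR_irreducible : Irreducible P.polyR := by
  have hprime : (Ideal.span {(p : Rp p)}).IsPrime := by
    rw [Ideal.span_singleton_prime (WittVector.p_nonzero p _)]
    exact (WittVector.irreducible p).prime
  have hdeg : P.polyR.natDegree = P.poly.natDegree := P.monic.natDegree_map _
  refine Polynomial.IsEisensteinAt.irreducible (𝓟 := Ideal.span {(p : Rp p)}) ?_ hprime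
    P.polyR_monic.isPrimitive (by have := P.two_le; omega)
  refine P.polyR_monic.isEisensteinAt_of_mem_of_notMem hprime.ne_top ?_ ?_
  · intro n hn
    have := P.eisenstein.mem (hdeg ▸ hn)
    obtain ⟨y, hy⟩ := Ideal.mem_span_singleton.1 this
    rw [EisensteinPoly.polyR, Polynomial.coeff_map, hy, map_mul, map_natCast]
    exact Ideal.mul_mem_right _ _ (Ideal.mem_span_singleton_self _)
  · intro h
    have h0 : P.poly.coeff 0 ∈ Ideal.span {(p : ℤ_[p])} :=
      P.eisenstein.mem (by have := P.two_le; omega)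
    obtain ⟨y, hy⟩ := Ideal.mem_span_singleton.1 h0
    rw [Ideal.span_singleton_pow, Ideal.mem_span_singleton, EisensteinPoly.polyR,
      Polynomial.coeff_map, hy, map_mul, map_natCast, pow_two] at h
    have h2 := fromZp_dvd ((mul_dvd_mul_iff_left (WittVector.p_nonzero p _)).1 h)
    apply P.eisenstein.notMem
    rw [hy, Ideal.span_singleton_pow, Ideal.mem_span_singleton, pow_two]
    exact mul_dvd_mul_left _ h2

/-- `R_π = R_p[π] = R_p[x] / (P)`. -/
abbrev Rpi : Type := AdjoinRoot P.polyR

/-- The root `π` of the Eisenstein polynomial in `R_π`. -/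
def piR : Rpi P := AdjoinRoot.root P.polyR

instance : IsDomain (Rpi P) :=
  AdjoinRoot.isDomain_of_prime P.polyR_irreducible.prime

/-- The extension of `φ` to `R_π` with `φ(π) = π`. -/
def phiPi : Rpi P →+* Rpi P :=
  AdjoinRoot.lift ((AdjoinRoot.of P.polyR).comp WittVector.frobenius) (AdjoinRoot.root P.polyR) (by
    have h : P.polyR.map (WittVector.frobenius (p := p)) = P.polyR := by
      rw [EisensteinPoly.polyR, Polynomial.map_map]
      congr 1
      exact RingHom.ext frobenius_fromZp
    rw [← Polynomial.eval₂_map, h, AdjoinRoot.eval₂_root])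

theorem piR_dvd_p : piR P ∣ (p : Rpi P) := by
  have h0 : P.poly.coeff 0 ∈ Ideal.span {(p : ℤ_[p])} :=
    P.eisenstein.mem (by have := P.two_le; omega)
  obtain ⟨y, hy⟩ := Ideal.mem_span_singleton.1 h0
  have hyu : IsUnit y := by
    by_contra hcon
    have hmem : y ∈ IsLocalRing.maximalIdeal ℤ_[p] := hcon
    rw [PadicInt.maximalIdeal_eq_span_p, Ideal.mem_span_singleton] at hmem
    apply P.eisenstein.notMem
    rw [hy, Ideal.span_singleton_pow, Ideal.mem_span_singleton, pow_two]
    exact mul_dvd_mul_left _ hmem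
  have hroot : Polynomial.eval₂ (AdjoinRoot.of P.polyR) (piR P) P.polyR = 0 :=
    AdjoinRoot.eval₂_root _
  have hsplit := Polynomial.X_mul_divX_add P.polyR
  have hroot' := (congrArg (Polynomial.eval₂ (AdjoinRoot.of P.polyR) (piR P)) hsplit).trans hroot
  rw [Polynomial.eval₂_add, Polynomial.eval₂_mul, Polynomial.eval₂_X,
    Polynomial.eval₂_C] at hroot'
  have hdvd : piR P ∣ AdjoinRoot.of P.polyR (P.polyR.coeff 0) :=
    (dvd_add_right (Dvd.intro _ rfl)).1 (hroot' ▸ dvd_zero _)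
  have hcoeff : P.polyR.coeff 0 = p * fromZp p y := by
    rw [EisensteinPoly.polyR, Polynomial.coeff_map, hy, map_mul, map_natCast]
  rw [hcoeff, map_mul, map_natCast] at hdvd
  exact ((hyu.map (fromZp p)).map (AdjoinRoot.of P.polyR)).dvd_mul_right.1 hdvd

theorem piR_ne_zero : piR P ≠ 0 := by
  intro h
  have h1 : (p : Rpi P) = 0 := by simpa [h] using piR_dvd_p P
  have hinj := AdjoinRoot.of.injective_of_degree_ne_zero (f := P.polyR) (by
    intro hd
    have h2 := Polynomial.natDegree_eq_zero_iff_degree_le_zero.2 hd.le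
    have h3 : P.polyR.natDegree = P.poly.natDegree := P.monic.natDegree_map _
    have := P.two_le
    omega)
  exact WittVector.p_nonzero p (AlgebraicClosure (ZMod p)) (hinj (by simpa using h1))

/-- `R_π` with uniformizer `π` and the Frobenius lift `φ`. -/
def basePi : FrobBase p (Rpi P) where
  ϖ := piR P
  ϖ_ne_zero := piR_ne_zero P
  dvd_p := piR_dvd_p P
  φ := phiPi P
  φ_ϖ := by simp [phiPi, piR]
  dvd_frob x := by
    have hp := (Fact.out : p.Prime)
    induction x using AdjoinRoot.induction_on with
    | ih f =>
      induction f using Polynomial.induction_on' with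
      | add f g hf hg =>
        obtain ⟨r, hr⟩ := exists_add_pow_prime_eq hp (AdjoinRoot.mk P.polyR f)
          (AdjoinRoot.mk P.polyR g)
        rw [map_add, hr, map_add, show ∀ a b c d e : Rpi P,
          a + b - (c + d + e) = (a - c) + (b - d) - e by intros; ring]
        refine dvd_sub (dvd_add hf hg) ?_
        rw [mul_assoc, mul_assoc]
        exact Dvd.dvd.mul_right (piR_dvd_p P) _
      | monomial n a =>
        rw [← Polynomial.C_mul_X_pow_eq_monomial, map_mul, map_pow, AdjoinRoot.mk_C,
          AdjoinRoot.mk_X, map_mul, map_pow]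
        have h1 : phiPi P (AdjoinRoot.root P.polyR) = piR P := by simp [phiPi, piR]
        have h2 : phiPi P (AdjoinRoot.of P.polyR a)
            = AdjoinRoot.of P.polyR (WittVector.frobenius a) := by simp [phiPi]
        rw [h1, h2]
        rcases Nat.eq_zero_or_pos n with rfl | hn
        · simp only [pow_zero, mul_one]
          rw [← map_pow, ← map_sub]
          refine (piR_dvd_p P).trans ?_
          have := map_dvd (AdjoinRoot.of P.polyR) ((baseP p).dvd_frob a)
          simpa [baseP] using this
        · refine dvd_sub (Dvd.dvd.mul_left (dvd_pow_self _ hn.ne') _) ?_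
          refine dvd_pow (Dvd.dvd.mul_left ?_ _) hp.ne_zero
          exact dvd_pow_self _ hn.ne'

/-- The element `p / π` of `R_π`. -/
def pDivPi : Rpi P := (piR_dvd_p P).choose

theorem piR_mul_pDivPi : piR P * pDivPi P = p := (piR_dvd_p P).choose_spec.symm

/-- The valuation on `R_π`, with uniformizer `π`, normalized by `v_p(p) = 1` (for `x ≠ 0`). -/
def vp (x : Rpi P) : ℚ := (multiplicity (piR P) x : ℚ) / (multiplicity (piR P) (p : Rpi P) : ℚ)

end Base

/-! ## Jet rings of a smooth algebra and the comparison map -/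

section Jets

variable (p : ℕ) [Fact p.Prime] (S : Type u) [CommRing S] [Algebra (Rp p) S]

/-- The relations of the tautological presentation `R_p[x_a : a ∈ S] → S`, `x_a ↦ a`. -/
def relP : Set (MvPolynomial S (Rp p)) :=
  {f | MvPolynomial.aeval (id : S → S) f = 0}

/-- The `r`-th ring of the universal `δ_p`-prolongation sequence of `S`. -/
abbrev JetP (r : ℕ) : Type u := JetRing (baseP p) (relP p S) r

/-- `S^r_p = 𝒪(J^r_p(Spec S))`, the `p`-adic completion of `JetP`. -/
abbrev Sp (r : ℕ) : Type u := AdicCompletion (Ideal.span {(p : JetP p S r)}) (JetP p S r)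

/-- The ring homomorphism `φ^r` from `S` to the `r`-th ring of its universal `δ_p`-prolongation
sequence. -/
def phiJet (r : ℕ) : S →+* JetP p S r :=
  (MvPolynomial.aeval (R := Rp p) (id : S → S)).toRingHom.liftOfRightInverse MvPolynomial.X
    (fun a => by simp)
    ⟨((toJet (baseP p) (relP p S) r).toRingHom.comp
        ((Phi (baseP p) (baseP p).ϖ) ^ r)).comp emb.toRingHom, by
      intro f hf
      have hf' : f ∈ relP p S := hf
      have h := Phi_iterate_mem (baseP p) dvd_rfl (emb f) r
      have hle : derivIdeal (baseP p) (baseP p).ϖ (emb f) r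
          ≤ RingHom.ker (toJet (baseP p) (relP p S) r).toRingHom := by
        rw [derivIdeal, Ideal.span_le]
        rintro _ ⟨j, hj, rfl⟩
        exact toJet_delta (baseP p) hf' hj
      have := hle h
      rw [RingHom.mem_ker] at this ⊢
      simpa [RingHom.coe_pow] using this⟩

variable {p} (P : EisensteinPoly p)

/-- The relations of the presentation `R_π[x_a : a ∈ S] → R_π ⊗ S` obtained from `relP` by base
change. -/
def relPi : Set (MvPolynomial S (Rpi P)) :=
  MvPolynomial.map (algebraMap (Rp p) (Rpi P)) '' relP p S

/-- The `r`-th ring of the universal `δ_π`-prolongation sequence of `R_π ⊗ S`. -/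
abbrev JetPi (r : ℕ) : Type u := JetRing (basePi P) (relPi S P) r

/-- `S^r_π = 𝒪(J^r_π(Spec (R_π ⊗ S)))`, the `p`-adic completion of `JetPi`. -/
abbrev Spi (r : ℕ) : Type u := AdicCompletion (Ideal.span {(p : JetPi S P r)}) (JetPi S P r)

/-- `R_π ⊗_{R_p} S^r_p`. -/
abbrev SpTensor (r : ℕ) : Type u := Rpi P ⊗[Rp p] Sp p S r

/-- The polynomial `δ_π^i x_a`, with coefficients in `R_π`, in `x_a, δ_p x_a, …, δ_p^i x_a`:
here `φ(δ_p^i x_a) = (δ_p^i x_a)^p + p δ_p^(i+1) x_a` and `δ_π f = (φ(f) - f^p) / π`. -/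
def deltaPiVar {ι : Type*} (a : ι) (i : ℕ) : MvPolynomial (ι × ℕ) (Rpi P) :=
  (delta (basePi P) (p : Rpi P))^[i] (MvPolynomial.X (a, 0))

/-- The evaluation `δ_p^i x_a ↦ 1 ⊗ δ_p^i a`, for polynomials of order `≤ r`. -/
def evalTensor (r : ℕ) :
    MvPolynomial (S × ℕ) (Rpi P) →ₐ[Rpi P] Rpi P ⊗[Rp p] JetP p S r :=
  MvPolynomial.aeval fun s => (1 : Rpi P) ⊗ₜ[Rp p] toJet (baseP p) (relP p S) r (MvPolynomial.X s)

theorem evalTensor_map (r : ℕ) (f : MvPolynomial (S × ℕ) (Rp p)) :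
    evalTensor S P r (MvPolynomial.map (algebraMap (Rp p) (Rpi P)) f)
      = (1 : Rpi P) ⊗ₜ[Rp p] toJet (baseP p) (relP p S) r f := by
  rw [evalTensor, MvPolynomial.aeval_map_algebraMap]
  have : (MvPolynomial.aeval (R := Rp p) fun s =>
        (1 : Rpi P) ⊗ₜ[Rp p] toJet (baseP p) (relP p S) r (MvPolynomial.X s))
      = (Algebra.TensorProduct.includeRight (A := Rpi P)).comp (toJet (baseP p) (relP p S) r) := by
    apply MvPolynomial.algHom_ext
    intro s
    simp
  rw [this]
  rfl

/-- The substitution `δ_π^i x_a ↦ deltaPiVar a i`. -/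
def subPi {ι : Type*} : MvPolynomial (ι × ℕ) (Rpi P) →ₐ[Rpi P] MvPolynomial (ι × ℕ) (Rpi P) :=
  MvPolynomial.aeval fun s => deltaPiVar P s.1 s.2

theorem subPi_Phi {ι : Type*} (f : MvPolynomial (ι × ℕ) (Rpi P)) :
    subPi P (Phi (basePi P) (basePi P).ϖ f) = Phi (basePi P) (p : Rpi P) (subPi P f) := by
  have : (subPi P).toRingHom.comp (Phi (basePi P) (basePi P).ϖ (ι := ι))
      = (Phi (basePi P) (p : Rpi P)).comp (subPi P).toRingHom := by
    apply MvPolynomial.ringHom_ext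
    · intro r
      simp [Phi, subPi]
    · intro s
      have h := Phi_eq (basePi P) (basePi P).dvd_p (deltaPiVar P s.1 s.2)
      have h2 : deltaPiVar P s.1 (s.2 + 1)
          = delta (basePi P) (p : Rpi P) (deltaPiVar P s.1 s.2) :=
        Function.iterate_succ_apply' _ _ _
      rw [← h2] at h
      simp only [AlgHom.toRingHom_eq_coe, RingHom.comp_apply, RingHom.coe_coe]
      have h3 : subPi P (MvPolynomial.X s) = deltaPiVar P s.1 s.2 := by simp [subPi]
      rw [h3, h]
      simp [Phi, subPi]
  exact congrArg (fun g => g f) this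

theorem subPi_delta {ι : Type*} (f : MvPolynomial (ι × ℕ) (Rpi P)) (i : ℕ) :
    subPi P ((delta (basePi P) (basePi P).ϖ)^[i] f)
      = (delta (basePi P) (p : Rpi P))^[i] (subPi P f) := by
  induction i with
  | zero => rfl
  | succ i ih =>
    rw [Function.iterate_succ_apply', Function.iterate_succ_apply', ← ih]
    exact delta_comm (basePi P) (basePi P) dvd_rfl (basePi P).dvd_p (subPi P).toRingHom
      (by simp [subPi]) (subPi_Phi P) _

theorem delta_map {ι : Type*} (f : MvPolynomial (ι × ℕ) (Rp p)) :
    delta (basePi P) (p : Rpi P) (MvPolynomial.map (algebraMap (Rp p) (Rpi P)) f)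
      = MvPolynomial.C (pDivPi P) *
        MvPolynomial.map (algebraMap (Rp p) (Rpi P)) (delta (baseP p) (baseP p).ϖ f) := by
  have hPhi : Phi (basePi P) (p : Rpi P) (MvPolynomial.map (algebraMap (Rp p) (Rpi P)) f)
      = MvPolynomial.map (algebraMap (Rp p) (Rpi P)) (Phi (baseP p) (baseP p).ϖ f) := by
    have : (Phi (basePi P) (p : Rpi P)).comp
          (MvPolynomial.map (σ := ι × ℕ) (algebraMap (Rp p) (Rpi P)))
        = (MvPolynomial.map (algebraMap (Rp p) (Rpi P))).comp (Phi (baseP p) (baseP p).ϖ) := by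
      apply MvPolynomial.ringHom_ext
      · intro r
        simp [Phi, basePi, baseP, phiPi, AdjoinRoot.algebraMap_eq]
      · intro s
        simp [Phi, baseP]
    exact congrArg (fun g => g f) this
  refine C_mul_cancel (basePi P) ?_
  rw [delta_spec _ (basePi P).dvd_p, hPhi, Phi_eq _ dvd_rfl, map_add, map_pow, add_sub_cancel_left,
    map_mul, ← mul_assoc, ← map_mul MvPolynomial.C]
  have : (basePi P).ϖ * pDivPi P = p := piR_mul_pDivPi P
  rw [this]
  simp [baseP]

theorem subPi_emb {ι : Type*} (f : MvPolynomial ι (Rp p)) :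
    subPi P (emb (MvPolynomial.map (algebraMap (Rp p) (Rpi P)) f))
      = MvPolynomial.map (algebraMap (Rp p) (Rpi P)) (emb f) := by
  have h : (subPi P).comp (emb (ι := ι)) = emb := by
    apply MvPolynomial.algHom_ext
    intro a
    simp [subPi, emb, deltaPiVar]
  rw [← AlgHom.comp_apply, h, emb, emb, MvPolynomial.map_rename]

/-- The relations defining `JetPi` hold in `R_π ⊗ JetP`. -/
theorem evalTensor_rel (r : ℕ) {f : MvPolynomial S (Rp p)} (hf : f ∈ relP p S) {i : ℕ}
    (hi : i ≤ r) : evalTensor S P r ((delta (basePi P) (p : Rpi P))^[i]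
      (MvPolynomial.map (algebraMap (Rp p) (Rpi P)) (emb f))) = 0 := by
  let K : ℕ → Ideal (MvPolynomial (S × ℕ) (Rpi P)) := fun i => Ideal.span
    {g | ∃ j ≤ i, g = MvPolynomial.map (algebraMap (Rp p) (Rpi P))
      ((delta (baseP p) (baseP p).ϖ)^[j] (emb f))}
  have hK : (delta (basePi P) (p : Rpi P))^[i]
      (MvPolynomial.map (algebraMap (Rp p) (Rpi P)) (emb f)) ∈ K i := by
    clear hi
    induction i with
    | zero => exact Ideal.subset_span ⟨0, le_rfl, rfl⟩
    | succ i ih =>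
      rw [Function.iterate_succ_apply']
      refine delta_mem (basePi P) (basePi P).dvd_p ?_ ?_ ih
      · rintro _ ⟨j, hj, rfl⟩
        exact Ideal.subset_span ⟨j, by omega, rfl⟩
      · rintro _ ⟨j, hj, rfl⟩
        rw [delta_map, ← Function.iterate_succ_apply' (delta (baseP p) (baseP p).ϖ)]
        exact Ideal.mul_mem_left _ _ (Ideal.subset_span ⟨j + 1, by omega, rfl⟩)
  have hle : K i ≤ RingHom.ker (evalTensor S P r).toRingHom := by
    rw [Ideal.span_le]
    rintro _ ⟨j, hj, rfl⟩
    rw [SetLike.mem_coe, RingHom.mem_ker]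
    change evalTensor S P r _ = 0
    rw [evalTensor_map, toJet_delta (baseP p) hf (hj.trans hi), TensorProduct.tmul_zero]
  exact hle hK

/-- The map `δ_π^i x_a ↦ δ_π^i (1 ⊗ a)` on polynomials of order `≤ r`. -/
def comparisonPre (r : ℕ) :
    MvPolynomial (S × Fin (r + 1)) (Rpi P) →ₐ[Rpi P] Rpi P ⊗[Rp p] JetP p S r :=
  MvPolynomial.aeval fun s => evalTensor S P r (deltaPiVar P s.1 s.2)

theorem comparisonPre_trunc (r : ℕ) {y : MvPolynomial (S × ℕ) (Rpi P)}
    (hy : y ∈ MvPolynomial.supported (Rpi P) {s : S × ℕ | s.2 ≤ r}) :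
    comparisonPre S P r (truncOrder r y) = evalTensor S P r (subPi P y) := by
  rw [MvPolynomial.supported] at hy
  induction hy using Algebra.adjoin_induction with
  | mem x hx =>
    obtain ⟨s, hs, rfl⟩ := hx
    have hs' : s.2 < r + 1 := Nat.lt_succ_of_le hs
    rw [truncOrder, MvPolynomial.aeval_X, dif_pos hs', comparisonPre, MvPolynomial.aeval_X,
      subPi, MvPolynomial.aeval_X]
  | algebraMap c => simp only [AlgHom.commutes]
  | add x y _ _ hx hy => simp only [map_add, hx, hy]
  | mul x y _ _ hx hy => simp only [map_mul, hx, hy]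

theorem comparisonPre_jetIdeal (r : ℕ) :
    jetIdeal (basePi P) (relPi S P) r ≤ RingHom.ker (comparisonPre S P r) := by
  rw [jetIdeal, Ideal.span_le]
  rintro _ ⟨_, ⟨f, hf, rfl⟩, i, hi, rfl⟩
  rw [SetLike.mem_coe, RingHom.mem_ker, comparisonPre_trunc, subPi_delta, subPi_emb]
  · exact evalTensor_rel S P r hf hi
  · have hsub : {s : S × ℕ | s.2 ≤ i} ⊆ {s : S × ℕ | s.2 ≤ r} := by
      intro s hs
      simp only [Set.mem_ofPred_eq] at hs ⊢
      exact hs.trans hi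
    exact MvPolynomial.supported_mono hsub
      (delta_iterate_supported (basePi P) dvd_rfl (emb_supported _) i)

/-- The canonical morphism of `δ_π`-prolongation sequences, before completion:
`δ_π^i a ↦ δ_π^i (1 ⊗ a)` for `a ∈ S`. -/
def comparison (r : ℕ) : JetPi S P r →ₐ[Rpi P] Rpi P ⊗[Rp p] JetP p S r :=
  Ideal.Quotient.liftₐ (jetIdeal (basePi P) (relPi S P) r) (comparisonPre S P r)
    (fun _ hx => comparisonPre_jetIdeal S P r hx)

end Jets

/-! ## Completeness of `R_π ⊗ S^r_p` and the comparison map on completions -/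

section Completion

/-- `M` is `p`-adically separated and complete. -/
def PComplete (p : ℕ) (M : Type*) [AddCommGroup M] : Prop :=
  (∀ x : M, (∀ n, ∃ y : M, x = p ^ n • y) → x = 0) ∧
  ∀ f : ℕ → M, (∀ m n, m ≤ n → ∃ y : M, f m - f n = p ^ m • y) →
    ∃ L : M, ∀ n, ∃ y : M, f n - L = p ^ n • y

theorem mem_span_pow_smul_top {p : ℕ} {A M : Type*} [CommRing A] [AddCommGroup M] [Module A M]
    (n : ℕ) (x : M) :
    x ∈ ((Ideal.span {(p : A)}) ^ n • ⊤ : Submodule A M) ↔ ∃ y : M, x = p ^ n • y := by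
  rw [Ideal.span_singleton_pow, Submodule.ideal_span_singleton_smul,
    Submodule.mem_smul_pointwise_iff_exists]
  constructor
  · rintro ⟨y, -, rfl⟩
    exact ⟨y, by rw [← Nat.cast_pow, Nat.cast_smul_eq_nsmul]⟩
  · rintro ⟨y, rfl⟩
    exact ⟨y, trivial, by rw [← Nat.cast_pow, Nat.cast_smul_eq_nsmul]⟩

theorem isAdicComplete_iff_pComplete {p : ℕ} {A M : Type*} [CommRing A] [AddCommGroup M]
    [Module A M] : IsAdicComplete (Ideal.span {(p : A)}) M ↔ PComplete p M := by
  constructor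
  · intro h
    refine ⟨fun x hx => h.toIsHausdorff.haus' x fun n => ?_, fun f hf => ?_⟩
    · rw [SModEq.sub_mem, sub_zero, mem_span_pow_smul_top]
      exact hx n
    · obtain ⟨L, hL⟩ := h.toIsPrecomplete.prec' f (fun {m n} hmn => by
        rw [SModEq.sub_mem, mem_span_pow_smul_top]
        exact hf m n hmn)
      refine ⟨L, fun n => ?_⟩
      have := hL n
      rwa [SModEq.sub_mem, mem_span_pow_smul_top] at this
  · rintro ⟨h1, h2⟩
    refine { haus' := fun x hx => h1 x fun n => ?_, prec' := fun f hf => ?_ }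
    · have := hx n
      rwa [SModEq.sub_mem, sub_zero, mem_span_pow_smul_top] at this
    · obtain ⟨L, hL⟩ := h2 f (fun m n hmn => by
        have := hf hmn
        rwa [SModEq.sub_mem, mem_span_pow_smul_top] at this)
      refine ⟨L, fun n => ?_⟩
      rw [SModEq.sub_mem, mem_span_pow_smul_top]
      exact hL n

theorem PComplete.pi {p : ℕ} {M ι : Type*} [AddCommGroup M] (h : PComplete p M) :
    PComplete p (ι → M) := by
  refine ⟨fun x hx => funext fun i => h.1 _ fun n => ?_, fun f hf => ?_⟩
  · obtain ⟨y, hy⟩ := hx n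
    exact ⟨y i, congrFun hy i⟩
  · have : ∀ i, ∃ L : M, ∀ n, ∃ y : M, f n i - L = p ^ n • y := fun i =>
      h.2 (fun n => f n i) fun m n hmn => by
        obtain ⟨y, hy⟩ := hf m n hmn
        exact ⟨y i, congrFun hy i⟩
    choose L hL using this
    refine ⟨L, fun n => ?_⟩
    choose y hy using fun i => hL i n
    exact ⟨y, funext hy⟩

theorem PComplete.equiv {p : ℕ} {M N : Type*} [AddCommGroup M] [AddCommGroup N] (e : M ≃+ N)
    (h : PComplete p M) : PComplete p N := by
  refine ⟨fun x hx => ?_, fun f hf => ?_⟩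
  · have : e.symm x = 0 := h.1 _ fun n => by
      obtain ⟨y, hy⟩ := hx n
      exact ⟨e.symm y, by rw [hy, map_nsmul]⟩
    simpa using this
  · obtain ⟨L, hL⟩ := h.2 (fun n => e.symm (f n)) fun m n hmn => by
      obtain ⟨y, hy⟩ := hf m n hmn
      exact ⟨e.symm y, by rw [← map_sub, hy, map_nsmul]⟩
    refine ⟨e L, fun n => ?_⟩
    obtain ⟨y, hy⟩ := hL n
    refine ⟨e y, ?_⟩
    have := congrArg e hy
    simpa using this

theorem span_pow_le_comap (p : ℕ) {A E : Type*} [CommRing A] [CommRing E] (f : A →+* E) (n : ℕ) :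
    (Ideal.span {(p : A)}) ^ n ≤ ((Ideal.span {(p : E)}) ^ n).comap f := by
  rw [← Ideal.map_le_iff_le_comap, Ideal.map_pow, Ideal.map_span, Set.image_singleton,
    map_natCast]

/-- The extension of a ring homomorphism `A → E` to the `p`-adic completion of `A`, for a
`p`-adically complete ring `E`. -/
def liftCompletion (p : ℕ) {A E : Type*} [CommRing A] [CommRing E]
    [IsAdicComplete (Ideal.span {(p : E)}) E] (f : A →+* E) :
    AdicCompletion (Ideal.span {(p : A)}) A →+* E :=
  IsAdicComplete.liftRingHom (Ideal.span {(p : E)})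
    (fun n => (Ideal.quotientMap ((Ideal.span {(p : E)}) ^ n) f (span_pow_le_comap p f n)).comp
      (AdicCompletion.evalₐ (Ideal.span {(p : A)}) n).toRingHom)
    (by
      intro m n hmn
      ext x
      induction x using AdicCompletion.induction_on with
      | _ a =>
        have h := AdicCompletion.Ideal.mk_eq_mk (Ideal.span {(p : A)}) hmn a
        simp only [AlgHom.toRingHom_eq_coe, RingHom.comp_apply, RingHom.coe_coe,
          AdicCompletion.evalₐ_mk, Ideal.quotientMap_mk]
        change Ideal.Quotient.mk (Ideal.span {(p : E)} ^ m) _ = Ideal.Quotient.mk _ _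
        rw [Ideal.Quotient.eq] at h ⊢
        rw [← map_sub]
        exact span_pow_le_comap p f m h)

variable {p : ℕ} [Fact p.Prime] (S : Type u) [CommRing S] [Algebra (Rp p) S]
  (P : EisensteinPoly p)

instance isAdicComplete_spTensor (r : ℕ) :
    IsAdicComplete (Ideal.span {(p : SpTensor S P r)}) (SpTensor S P r) := by
  rw [isAdicComplete_iff_pComplete]
  have h1 : PComplete p (Sp p S r) :=
    (isAdicComplete_iff_pComplete (A := JetP p S r)).1
      (AdicCompletion.isAdicComplete ⟨{(p : JetP p S r)}, by simp⟩)
  let b := (AdjoinRoot.powerBasis' P.polyR_monic).basis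
  let e : Rpi P ⊗[Rp p] Sp p S r ≃ₗ[Rp p] (_ → Sp p S r) :=
    (TensorProduct.comm _ _ _).trans ((TensorProduct.congr (LinearEquiv.refl _ _) b.equivFun).trans
      (TensorProduct.piScalarRight (Rp p) (Rp p) (Sp p S r) _))
  exact h1.pi.equiv e.symm.toAddEquiv

/-- The canonical map `S^r_π → R_π ⊗ S^r_p`. -/
def tra (r : ℕ) : Spi S P r →+* SpTensor S P r :=
  liftCompletion p ((Algebra.TensorProduct.map (AlgHom.id (Rp p) (Rpi P))
    (Algebra.ofId (JetP p S r) (Sp p S r) |>.restrictScalars (Rp p))).toRingHom.comp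
      (comparison S P r).toRingHom)

end Completion

/-! ## Power series in `T, δT, …, δ^r T` -/

section Series

/-- Setting `T = 0`: the variable `(j, 0)`, i.e. `T_j`, goes to `0`, and `(j, i + 1)`, i.e.
`δ^(i+1) T_j`, goes to the variable `(j, i)` of a series in `δT, …, δ^r T`. (Only variables of
order `≤ r` occur where this is used.) -/
def tailVar (r : ℕ) {J R : Type*} [CommRing R] : J × ℕ → MvPolynomial (J × Fin r) R
  | (_, 0) => 0
  | (j, i + 1) => if h : i < r then MvPolynomial.X (j, ⟨i, h⟩) else 0

/-- `f ↦ f|_{T = 0}` for polynomials. -/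
def setZeroPoly (r : ℕ) {J R : Type*} [CommRing R] :
    MvPolynomial (J × ℕ) R →ₐ[R] MvPolynomial (J × Fin r) R :=
  MvPolynomial.aeval (tailVar r)

/-- `f ↦ f|_{T = 0}` for power series. -/
def setZero (r : ℕ) {J R : Type*} [CommRing R] (f : MvPowerSeries (J × ℕ) R) :
    MvPowerSeries (J × Fin r) R :=
  f.subst fun s => ((tailVar r s : MvPolynomial (J × Fin r) R) : MvPowerSeries (J × Fin r) R)

theorem constantCoeff_setZeroPoly (r : ℕ) {J R : Type*} [CommRing R]
    (f : MvPolynomial (J × ℕ) R) :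
    MvPolynomial.constantCoeff (setZeroPoly r f) = MvPolynomial.constantCoeff f := by
  induction f using MvPolynomial.induction_on with
  | C a => simp [setZeroPoly]
  | add f g hf hg => rw [map_add, map_add, map_add, hf, hg]
  | mul_X f s hf =>
    rw [map_mul, map_mul, map_mul, hf, MvPolynomial.constantCoeff_X, mul_zero]
    have : MvPolynomial.constantCoeff (setZeroPoly r (MvPolynomial.X s : MvPolynomial (J × ℕ) R))
        = 0 := by
      rw [setZeroPoly, MvPolynomial.aeval_X]
      rcases s with ⟨j, _ | i⟩
      · simp [tailVar]
      · simp only [tailVar]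
        split_ifs <;> simp
    rw [this, mul_zero]

/-- A power series over `A` is restricted if its coefficients tend to `0` `p`-adically. For a
`p`-adically complete `A` the restricted series in variables `x` form the `p`-adic completion of
`A[x]`. -/
def IsRestricted (p : ℕ) {σ A : Type*} [CommRing A] (f : MvPowerSeries σ A) : Prop :=
  ∀ m : ℕ, {d : σ →₀ ℕ | MvPowerSeries.coeff d f ∉ Ideal.span {(p : A) ^ m}}.Finite

variable {p : ℕ} [Fact p.Prime] (S : Type u) [CommRing S] [Algebra (Rp p) S]
  (P : EisensteinPoly p)

/-- The image of `δ_π^(i+1) T_j` in `(R_π ⊗ S^r_p)[δ_p T, …, δ_p^r T]`, for `s = (j, i)`. -/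
def deltaPiT (r : ℕ) {J : Type*} (s : J × Fin r) :
    MvPowerSeries (J × Fin r) (SpTensor S P r) :=
  (MvPolynomial.map (algebraMap (Rpi P) (SpTensor S P r))
    (setZeroPoly r (deltaPiVar P s.1 (s.2 + 1))) : MvPolynomial (J × Fin r) (SpTensor S P r))

theorem hasSubst_deltaPiT (r : ℕ) {J : Type*} [Finite J] :
    MvPowerSeries.HasSubst (deltaPiT S P r (J := J)) := by
  refine MvPowerSeries.hasSubst_of_constantCoeff_zero fun s => ?_
  have h : MvPolynomial.constantCoeff (setZeroPoly r (deltaPiVar P s.1 (s.2 + 1))) = 0 := by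
    rw [constantCoeff_setZeroPoly]
    exact constantCoeff_delta_iterate (basePi P) (basePi P).dvd_p _ _
  rw [deltaPiT, ← MvPowerSeries.coeff_zero_eq_constantCoeff_apply, MvPolynomial.coeff_coe,
    MvPolynomial.coeff_map, ← MvPolynomial.constantCoeff_eq, h, map_zero]

/-- The natural homomorphism `S^r_π[[δ_π T, …, δ_π^r T]] → (R_π ⊗ S^r_p)[[δ_p T, …, δ_p^r T]]`
for a tuple `T = (T_j)`; its restriction to restricted power series is the natural homomorphism
`S^r_π[δ_π T, …, δ_π^r T]^ → (R_π ⊗ S^r_p)[δ_p T, …, δ_p^r T]^`. -/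
def natHom (r : ℕ) (J : Type*) [Finite J] :
    MvPowerSeries (J × Fin r) (Spi S P r) →+* MvPowerSeries (J × Fin r) (SpTensor S P r) :=
  (MvPowerSeries.substAlgHom (R := SpTensor S P r)
    (hasSubst_deltaPiT S P r (J := J))).toRingHom.comp (MvPowerSeries.map (tra S P r))

variable {S}

/-- The `p`-derivation's ring homomorphism `φ` on power series in `T, δ_p T, δ_p² T, …` with
coefficients in the polynomial ring `R_p[x_a, δ_p x_a, … : a ∈ S]`. -/
def PhiSeries {J : Type*} (f : MvPowerSeries (J × ℕ) (MvPolynomial (S × ℕ) (Rp p))) :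
    MvPowerSeries (J × ℕ) (MvPolynomial (S × ℕ) (Rp p)) :=
  (f.map (Phi (baseP p) (baseP p).ϖ)).subst fun s =>
    (MvPowerSeries.X s ^ p + (p : MvPowerSeries (J × ℕ) (MvPolynomial (S × ℕ) (Rp p)))
      * MvPowerSeries.X (s.1, s.2 + 1))

open Classical in
/-- The `p`-derivation `f ↦ (φ(f) - f^p) / p` on the same (torsion free) power series ring. -/
def deltaSeries {J : Type*} (f : MvPowerSeries (J × ℕ) (MvPolynomial (S × ℕ) (Rp p))) :
    MvPowerSeries (J × ℕ) (MvPolynomial (S × ℕ) (Rp p)) :=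
  if h : ∃ g : MvPowerSeries (J × ℕ) (MvPolynomial (S × ℕ) (Rp p)), p * g = PhiSeries f - f ^ p
  then h.choose else 0

theorem hasSubst_PhiSeries {A J : Type*} [CommRing A] :
    MvPowerSeries.HasSubst fun s : J × ℕ =>
      (MvPowerSeries.X s ^ p + (p : MvPowerSeries (J × ℕ) A) * MvPowerSeries.X (s.1, s.2 + 1)) := by
  refine (MvPowerSeries.HasSubst.X_pow (Fact.out : p.Prime).ne_zero).add
    (MvPowerSeries.HasSubst.mul_left _ ?_)
  refine ⟨fun s => by simp, fun d => ?_⟩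
  classical
  have hinj : Function.Injective fun s : J × ℕ => (s.1, s.2 + 1) := by
    rintro ⟨a, i⟩ ⟨b, j⟩ h
    simpa using h
  refine Set.Finite.subset (((MvPowerSeries.HasSubst.X (σ := J × ℕ) (S := A)).coeff_zero d).preimage
    hinj.injOn) ?_
  intro s hs
  exact hs

/-- The division in the definition of `deltaSeries` is always possible. -/
theorem deltaSeries_spec {J S : Type*} (f : MvPowerSeries (J × ℕ) (MvPolynomial (S × ℕ) (Rp p))) :
    p * deltaSeries f = PhiSeries f - f ^ p := by
  classical
  suffices h : ∃ g : MvPowerSeries (J × ℕ) (MvPolynomial (S × ℕ) (Rp p)),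
      p * g = PhiSeries f - f ^ p by
    rw [deltaSeries, dif_pos h]
    exact h.choose_spec
  let I : Ideal (MvPolynomial (S × ℕ) (Rp p)) := Ideal.span {(p : MvPolynomial (S × ℕ) (Rp p))}
  let q := Ideal.Quotient.mk I
  have hq0 : ((p : ℕ) : MvPolynomial (S × ℕ) (Rp p) ⧸ I) = 0 := by
    rw [← map_natCast q]
    exact Ideal.Quotient.eq_zero_iff_mem.2 (Ideal.mem_span_singleton_self _)
  suffices h : (PhiSeries f - f ^ p).map q = 0 by
    have hd : ∀ d, ∃ c, MvPowerSeries.coeff d (PhiSeries f - f ^ p) = p * c := fun d => by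
      have := congrArg (MvPowerSeries.coeff d) h
      rw [MvPowerSeries.coeff_map, map_zero] at this
      exact Ideal.mem_span_singleton.1 (Ideal.Quotient.eq_zero_iff_mem.1 this)
    choose c hc using hd
    let g : MvPowerSeries (J × ℕ) (MvPolynomial (S × ℕ) (Rp p)) := fun d => c d
    have hg : ∀ d, MvPowerSeries.coeff d g = c d := fun d => rfl
    refine ⟨g, ?_⟩
    ext1 d
    rw [hc, ← map_natCast (MvPowerSeries.C (σ := J × ℕ)), MvPowerSeries.coeff_C_mul, hg]
  rcases subsingleton_or_nontrivial (MvPolynomial (S × ℕ) (Rp p) ⧸ I) with hsub | hnon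
  · ext d
    exact Subsingleton.elim _ _
  have : CharP (MvPolynomial (S × ℕ) (Rp p) ⧸ I) p :=
    ringChar.of_eq (CharP.ringChar_of_prime_eq_zero (Fact.out : p.Prime) hq0)
  have : ExpChar (MvPolynomial (S × ℕ) (Rp p) ⧸ I) p := ExpChar.prime Fact.out
  have hcomp : q.comp (Phi (baseP p) (baseP p).ϖ) = (frobenius _ p).comp q := by
    refine RingHom.ext fun g => ?_
    have := delta_spec (baseP p) dvd_rfl g
    rw [RingHom.comp_apply, RingHom.comp_apply, frobenius_def, ← map_pow, ← sub_eq_zero, ← map_sub,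
      ← this, map_mul]
    have h0 : q (MvPolynomial.C (baseP p).ϖ) = 0 := by
      simp [baseP]
    rw [h0, zero_mul]
  rw [map_sub, map_pow, PhiSeries, MvPowerSeries.map_subst hasSubst_PhiSeries,
    ← MvPowerSeries.map_frobenius_expand (p := p) (hp := (Fact.out : p.Prime).ne_zero), sub_eq_zero,
    MvPowerSeries.map_expand, MvPowerSeries.expand, MvPowerSeries.substAlgHom_apply]
  have h1 : ((f.map (Phi (baseP p) (baseP p).ϖ)).map q) = ((f.map q).map (frobenius _ p)) := by
    ext1 d
    simp only [MvPowerSeries.coeff_map]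
    exact congrArg (fun g => g (MvPowerSeries.coeff d f)) hcomp
  have h2 : (p : MvPowerSeries (J × ℕ) (MvPolynomial (S × ℕ) (Rp p) ⧸ I)) = 0 := by
    rw [← map_natCast (MvPowerSeries.C (σ := J × ℕ)), hq0, map_zero]
  rw [h1]
  congr 1
  funext s
  simp [h2]

/-- The tautological lift `∑ x_{a_α} T^α` of a series `∑ a_α T^α` over `S`. -/
def liftSeries (p : ℕ) [Fact p.Prime] {J : Type*} (f : MvPowerSeries J S) :
    MvPowerSeries (J × ℕ) (MvPolynomial (S × ℕ) (Rp p)) :=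
  MvPowerSeries.subst (fun j => (MvPowerSeries.X (j, 0) :
      MvPowerSeries (J × ℕ) (MvPolynomial (S × ℕ) (Rp p))))
    (fun d => MvPolynomial.X (MvPowerSeries.coeff d f, 0) :
      MvPowerSeries J (MvPolynomial (S × ℕ) (Rp p)))

/-- The projection `R_p[x_a, δ_p x_a, … : a ∈ S] → S^r_p`, `δ_p^i x_a ↦ δ_p^i a` (for polynomials
of order `≤ r`). -/
def toSp (S : Type u) [CommRing S] [Algebra (Rp p) S] (r : ℕ) :
    MvPolynomial (S × ℕ) (Rp p) →+* Sp p S r :=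
  (algebraMap (JetP p S r) (Sp p S r)).comp (toJet (baseP p) (relP p S) r).toRingHom

/-- `{δ_p^r f}|_{T = 0}` for a power series `f` over `S`. The projection `toSp` from the torsion
free rings `R_p[x_a, …, δ_p^r x_a]` is compatible with the `p`-derivations, so `δ_p^r f` is the
image of `δ_p^r` of any lift of `f`. -/
def jetSeries (p : ℕ) [Fact p.Prime] {J S : Type*} [CommRing S] [Algebra (Rp p) S]
    (r : ℕ) (f : MvPowerSeries J S) : MvPowerSeries (J × Fin r) (Sp p S r) :=
  setZero r ((deltaSeries^[r] (liftSeries p f)).map (toSp S r))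

/-- `ℚ ⊗ A`. -/
def RatTensor (A : Type*) [CommRing A] : Type _ := ℚ ⊗[ℤ] A

instance (A : Type*) [CommRing A] : CommRing (RatTensor A) :=
  inferInstanceAs (CommRing (ℚ ⊗[ℤ] A))

instance (A : Type*) [CommRing A] : Algebra ℚ (RatTensor A) :=
  inferInstanceAs (Algebra ℚ (ℚ ⊗[ℤ] A))

/-- The canonical map `A → ℚ ⊗ A`. -/
def toRat (A : Type*) [CommRing A] : A →+* RatTensor A :=
  (Algebra.TensorProduct.includeRight : A →ₐ[ℤ] ℚ ⊗[ℤ] A).toRingHom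

/-- Functoriality of `ℚ ⊗ A`. -/
def ratMap {A B : Type*} [CommRing A] [CommRing B] (f : A →+* B) : RatTensor A →+* RatTensor B :=
  (Algebra.TensorProduct.map (AlgHom.id ℤ ℚ) f.toIntAlgHom).toRingHom

/-- The logarithm `l(T) = ∑ a_n T^n = ∫ dT / (∂F/∂X)(0, T)` of a formal group law `F(X, Y)`. -/
def formalLog {S : Type*} [CommRing S] (F : FormalGroup S) : PowerSeries (RatTensor S) :=
  PowerSeries.mk fun n => (1 / n : ℚ) • toRat S (PowerSeries.coeff (n - 1)
    (PowerSeries.invOfUnit (PowerSeries.mk fun k =>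
      MvPowerSeries.coeff (Finsupp.single 0 1 + Finsupp.single 1 k) F.toPowerSeries) 1))

/-- `φ^r(T)`, a polynomial in `T, δ_p T, …, δ_p^r T`, over `ℚ ⊗ S^r_p`. -/
def phiT (p : ℕ) [Fact p.Prime] (S : Type u) [CommRing S] [Algebra (Rp p) S] (r : ℕ) :
    MvPowerSeries (Unit × ℕ) (RatTensor (Sp p S r)) :=
  (MvPolynomial.map ((toRat (Sp p S r)).comp (algebraMap (Rp p) (Sp p S r)))
    ((Phi (baseP p) (baseP p).ϖ)^[r] (MvPolynomial.X ((), 0))) :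
      MvPolynomial (Unit × ℕ) (RatTensor (Sp p S r)))

/-- `φ^r : S → S^r_p`. -/
def phiSp (p : ℕ) [Fact p.Prime] (S : Type u) [CommRing S] [Algebra (Rp p) S] (r : ℕ) :
    S →+* Sp p S r :=
  (algebraMap (JetP p S r) (Sp p S r)).comp (phiJet p S r)

/-- `L^r_p = (1/p) {φ^r(l(T))}|_{T = 0}`, where `l` is the logarithm of `F`. -/
def Lp (p : ℕ) [Fact p.Prime] {S : Type u} [CommRing S] [Algebra (Rp p) S] (F : FormalGroup S)
    (r : ℕ) : MvPowerSeries (Unit × Fin r) (RatTensor (Sp p S r)) :=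
  (1 / p : ℚ) • setZero r
    (PowerSeries.subst (phiT p S r) ((formalLog F).map (ratMap (phiSp p S r))))

/-- The inclusion `S^r_p → R_π ⊗ S^r_p`. -/
def inclTensor (S : Type u) [CommRing S] [Algebra (Rp p) S] (P : EisensteinPoly p) (r : ℕ) :
    Sp p S r →+* SpTensor S P r :=
  (Algebra.TensorProduct.includeRight : Sp p S r →ₐ[Rp p] Rpi P ⊗[Rp p] Sp p S r).toRingHom

/-- `L^r_π = (p/π) L^r_p`, over `ℚ ⊗ (R_π ⊗ S^r_p)`. -/
def Lpi {S : Type u} [CommRing S] [Algebra (Rp p) S] (F : FormalGroup S) (P : EisensteinPoly p)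
    (r : ℕ) : MvPowerSeries (Unit × Fin r) (RatTensor (SpTensor S P r)) :=
  MvPowerSeries.C (toRat (SpTensor S P r) (algebraMap (Rpi P) (SpTensor S P r) (pDivPi P))) *
    (Lp p F r).map (ratMap (inclTensor S P r))

end Series

end PiJet

end

/-! Both prolongations carry the same Frobenius lift φ; they differ only in the denominator of the
derivation. The natural homomorphism therefore sends φ^i of a coefficient, and φ^i(T), to the same
expressions on the δ_p side (`tra_Phi_iterate_X`, `subPi_Phi_iterate_X`).

On the δ_π side, φ^i(T)|_{T=0} = π Q_i, where Q_i is a polynomial over R_π in δ_π T, …, δ_π^r T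
without constant term (`phiQuot`). The image of Q_i is φ^i(T)|_{T=0} / π in the δ_p variables
(`C_mul_subPiT_phiQuot`). So for f = ∑ a_α T^α and i ≤ r, φ^i(f)|_{T=0} = ∑ φ^i(a_α) (π Q_i)^α = ∑
π^{|α|} φ^i(a_α) Q_i^α. Since p ∣ π^e, the coefficients tend to 0 p-adically. The right side is thus
the image of a restricted series in the δ_π variables (`exists_natHom_eq_evalZero`).

Part 1: solving φ(g) = g^p + p δ_p g for δ_p g repeatedly shows that some p^n δ_p^r f is an integer
polynomial in f, φ(f), …, φ^r(f) (`exists_pow_mul_deltaSeries_mem`). The image of the restricted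
series is a subring, so it contains p^n δ_p^r f at T = 0.

Part 2: the logarithm is ∑ (b_{n-1}/n) T^n with b_{n-1} ∈ S, so L^r_π = (1/π) ∑ φ^r(b_{n-1}) (π
Q_r)^n / n = ∑ φ^r(b_{n-1}) (π^{n-1}/n) Q_r^n. The condition on v_p(π) forces e ≤ p - 1, hence p ∣
π^{p-1}. Then π^{n-1}/n is integral and tends to 0 (`exists_divided_powers`), so the series is again
restricted. -/

noncomputable section

namespace PiJet

open scoped TensorProduct

universe u

/-! ## Restricted power series -/

section Restricted

variable {p : ℕ} {σ τ A : Type*} [CommRing A]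

theorem isRestricted_C (a : A) : IsRestricted p (MvPowerSeries.C (σ := σ) a) := by
  classical
  refine fun m => (Set.finite_singleton 0).subset fun d hd => ?_
  by_contra h
  refine hd ?_
  rw [MvPowerSeries.coeff_C, if_neg (by simpa using h)]
  exact Ideal.zero_mem _

theorem IsRestricted.add {f g : MvPowerSeries σ A} (hf : IsRestricted p f)
    (hg : IsRestricted p g) : IsRestricted p (f + g) := by
  refine fun m => ((hf m).union (hg m)).subset fun d hd => ?_
  by_contra h
  simp only [Set.mem_union, Set.mem_ofPred_eq, not_or, not_not] at h
  exact hd (by rw [map_add]; exact Ideal.add_mem _ h.1 h.2)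

theorem IsRestricted.mul {f g : MvPowerSeries σ A} (hf : IsRestricted p f)
    (hg : IsRestricted p g) : IsRestricted p (f * g) := by
  classical
  -- A bad exponent of the product must be a sum of bad exponents of the factors, and the sumset of
  -- two finite sets is finite.
  refine fun m => ((hf m).add (hg m)).subset fun d hd => ?_
  by_contra h
  refine hd ?_
  rw [MvPowerSeries.coeff_mul]
  refine Ideal.sum_mem _ fun x hx => ?_
  rw [Finset.HasAntidiagonal.mem_antidiagonal] at hx
  by_cases h1 : MvPowerSeries.coeff x.1 f ∈ Ideal.span {(p : A) ^ m}
  · exact Ideal.mul_mem_right _ _ h1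
  · by_cases h2 : MvPowerSeries.coeff x.2 g ∈ Ideal.span {(p : A) ^ m}
    · exact Ideal.mul_mem_left _ _ h2
    · exact absurd ⟨x.1, h1, x.2, h2, hx⟩ h

/-- The restricted power series form a subring. -/
def restrictedSubring (p : ℕ) (σ A : Type*) [CommRing A] : Subring (MvPowerSeries σ A) where
  carrier := {f | IsRestricted p f}
  mul_mem' := IsRestricted.mul
  one_mem' := by simpa using isRestricted_C (p := p) (σ := σ) (1 : A)
  add_mem' := IsRestricted.add
  zero_mem' := by simpa using isRestricted_C (p := p) (σ := σ) (0 : A)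
  neg_mem' {f} hf := by
    have := (isRestricted_C (p := p) (σ := σ) (-1 : A)).mul hf
    simpa using this

theorem coe_prod_pow (w : τ → MvPolynomial σ A) (d : τ →₀ ℕ) :
    (d.prod fun s e => (w s : MvPowerSeries σ A) ^ e)
      = ((d.prod fun s e => w s ^ e : MvPolynomial σ A) : MvPowerSeries σ A) := by
  rw [Finsupp.prod, Finsupp.prod]
  have := map_prod (MvPolynomial.coeToMvPowerSeries.ringHom (σ := σ) (R := A))
    (fun s => w s ^ d s) d.support
  simp only [map_pow, MvPolynomial.coeToMvPowerSeries.ringHom_apply] at this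
  exact this.symm

/-- Substituting polynomials into a restricted series gives a restricted series. -/
theorem IsRestricted.subst {w : τ → MvPolynomial σ A}
    (hw : MvPowerSeries.HasSubst fun j => (w j : MvPowerSeries σ A)) {g : MvPowerSeries τ A}
    (hg : IsRestricted p g) :
    IsRestricted p (g.subst fun j => (w j : MvPowerSeries σ A)) := by
  -- Modulo `p ^ m` only finitely many monomials of `g` survive. Each becomes a polynomial, so the
  -- bad exponents lie in a finite union of finite supports.
  refine fun m => ((hg m).biUnion fun d _ =>
    (d.prod fun s e => w s ^ e).support.finite_toSet).subset fun e he => ?_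
  by_contra hn
  refine he ?_
  rw [MvPowerSeries.coeff_subst hw]
  refine finsum_induction (· ∈ Ideal.span {(p : A) ^ m}) (Ideal.zero_mem _)
    (fun _ _ => Ideal.add_mem _) fun d => ?_
  rw [smul_eq_mul, coe_prod_pow, MvPolynomial.coeff_coe]
  by_cases hd : MvPowerSeries.coeff d g ∈ Ideal.span {(p : A) ^ m}
  · exact Ideal.mul_mem_right _ _ hd
  · have : MvPolynomial.coeff e (d.prod fun s e => w s ^ e) = 0 := by
      by_contra h0
      exact hn (Set.mem_biUnion hd (by simpa using h0))
    rw [this, mul_zero]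
    exact Ideal.zero_mem _

/-- The power series with given coefficients. -/
def ofCoeff (a : (τ →₀ ℕ) → A) : MvPowerSeries τ A := a

@[simp]
theorem coeff_ofCoeff (a : (τ →₀ ℕ) → A) (d : τ →₀ ℕ) :
    MvPowerSeries.coeff d (ofCoeff a) = a d := rfl

theorem map_ofCoeff {B : Type*} [CommRing B] (f : A →+* B) (a : (τ →₀ ℕ) → A) :
    (ofCoeff a).map f = ofCoeff fun d => f (a d) := by
  ext d
  simp

/-- A common factor of the substituted series can be moved into the coefficients. -/
theorem subst_C_mul {w w' : τ → MvPowerSeries σ A} (hw : MvPowerSeries.HasSubst w)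
    (hw' : MvPowerSeries.HasSubst w') {c : A} (h : ∀ j, w' j = MvPowerSeries.C c * w j)
    (g : MvPowerSeries τ A) :
    g.subst w' = (ofCoeff fun d => c ^ d.degree * MvPowerSeries.coeff d g).subst w := by
  ext e
  rw [MvPowerSeries.coeff_subst hw, MvPowerSeries.coeff_subst hw']
  refine finsum_congr fun d => ?_
  have h1 : (d.prod fun s e => w' s ^ e)
      = MvPowerSeries.C (c ^ d.degree) * d.prod fun s e => w s ^ e := by
    simp only [Finsupp.prod, h, mul_pow, Finset.prod_mul_distrib]
    rw [Finset.prod_pow_eq_pow_sum, map_pow]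
    rfl
  rw [h1, coeff_ofCoeff, MvPowerSeries.coeff_C_mul, smul_eq_mul, smul_eq_mul]
  ring

theorem hasSubst_coe [Finite τ] {w : τ → MvPolynomial σ A}
    (hw : ∀ j, MvPolynomial.constantCoeff (w j) = 0) :
    MvPowerSeries.HasSubst fun j => (w j : MvPowerSeries σ A) :=
  MvPowerSeries.hasSubst_of_constantCoeff_zero fun j => by
    rw [← MvPowerSeries.coeff_zero_eq_constantCoeff_apply, MvPolynomial.coeff_coe,
      ← MvPolynomial.constantCoeff_eq, hw]

theorem map_coe {B : Type*} [CommRing B] (f : A →+* B) (y : MvPolynomial σ A) :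
    (y : MvPowerSeries σ A).map f = (MvPolynomial.map f y : MvPolynomial σ B) := by
  ext d
  simp [MvPolynomial.coeff_map]

theorem subst_coe_coe (w : τ → MvPolynomial σ A) (y : MvPolynomial τ A) :
    MvPowerSeries.subst (fun j => (w j : MvPowerSeries σ A)) (y : MvPowerSeries τ A)
      = (MvPolynomial.aeval w y : MvPolynomial σ A) := by
  rw [MvPowerSeries.subst_coe]
  have : (MvPolynomial.aeval fun j => (w j : MvPowerSeries σ A))
      = (MvPolynomial.coeToMvPowerSeries.algHom A).comp (MvPolynomial.aeval w) := by
    apply MvPolynomial.algHom_ext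
    intro s
    simp
  rw [this]
  simp

end Restricted

/-! ## Powers of the Frobenius lift on polynomials -/

section Polynomials

variable {p : ℕ} {R : Type*} [CommRing R] (B : FrobBase p R) {ι : Type*}

theorem Phi_supported [Fact p.Prime] [IsDomain R] {c : R} (hc : B.ϖ ∣ c) (n : ℕ)
    {f : MvPolynomial (ι × ℕ) R} (hf : f ∈ MvPolynomial.supported R {s : ι × ℕ | s.2 ≤ n}) :
    Phi B c f ∈ MvPolynomial.supported R {s : ι × ℕ | s.2 ≤ n + 1} := by
  rw [Phi_eq B hc]
  have hmono : MvPolynomial.supported R {s : ι × ℕ | s.2 ≤ n}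
      ≤ MvPolynomial.supported R {s : ι × ℕ | s.2 ≤ n + 1} :=
    MvPolynomial.supported_mono fun s (hs : s.2 ≤ n) => (by simp; omega)
  exact add_mem (pow_mem (hmono hf) p)
    (mul_mem (Subalgebra.algebraMap_mem _ B.ϖ) (delta_supported B hc n hf))

/-- `truncOrder r` and `setZeroPoly r` discard variables of order above `r`. This bound on the order
of φ^i(T) is what makes them compatible with the substitutions below. -/
theorem Phi_iterate_X_supported [Fact p.Prime] [IsDomain R] {c : R} (hc : B.ϖ ∣ c) (a : ι)
    {i r : ℕ} (hi : i ≤ r) :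
    (Phi B c)^[i] (MvPolynomial.X (a, 0))
      ∈ MvPolynomial.supported R {s : ι × ℕ | s.2 ≤ r} := by
  have h : (Phi B c)^[i] (MvPolynomial.X (a, 0))
      ∈ MvPolynomial.supported R {s : ι × ℕ | s.2 ≤ i} := by
    clear hi
    induction i with
    | zero => exact Algebra.subset_adjoin ⟨_, by simp, rfl⟩
    | succ i ih => rw [Function.iterate_succ_apply']; exact Phi_supported B hc i ih
  refine MvPolynomial.supported_mono (fun s hs => ?_) h
  simp only [Set.mem_ofPred_eq] at hs ⊢
  omega

theorem constantCoeff_Phi [Fact p.Prime] (c : R) (f : MvPolynomial (ι × ℕ) R) :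
    MvPolynomial.constantCoeff (Phi B c f) = B.φ (MvPolynomial.constantCoeff f) := by
  have : (MvPolynomial.constantCoeff (σ := ι × ℕ)).comp (Phi B c)
      = B.φ.comp MvPolynomial.constantCoeff := by
    apply MvPolynomial.ringHom_ext
    · intro a
      simp [Phi]
    · intro s
      simp [Phi, (Fact.out : p.Prime).ne_zero]
  exact congrArg (fun g => g f) this

theorem constantCoeff_Phi_iterate_X [Fact p.Prime] (c : R) (s : ι × ℕ) (i : ℕ) :
    MvPolynomial.constantCoeff ((Phi B c)^[i] (MvPolynomial.X s)) = 0 := by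
  induction i with
  | zero => simp
  | succ i ih => rw [Function.iterate_succ_apply', constantCoeff_Phi, ih, map_zero]

theorem setZeroPoly_map {R' : Type*} [CommRing R'] (f : R →+* R') (r : ℕ)
    (y : MvPolynomial (ι × ℕ) R) :
    setZeroPoly r (MvPolynomial.map f y) = MvPolynomial.map f (setZeroPoly r y) := by
  have : (setZeroPoly r (J := ι)).toRingHom.comp (MvPolynomial.map f)
      = (MvPolynomial.map f).comp (setZeroPoly r).toRingHom := by
    apply MvPolynomial.ringHom_ext
    · intro a
      simp [setZeroPoly]
    · rintro ⟨a, _ | i⟩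
      · simp [setZeroPoly, tailVar]
      · simp only [setZeroPoly, AlgHom.toRingHom_eq_coe, RingHom.comp_apply, RingHom.coe_coe,
          MvPolynomial.map_X, MvPolynomial.aeval_X, tailVar]
        split_ifs <;> simp
  exact congrArg (fun g => g y) this

/-- `φ^i(T)|_{T = 0}` is divisible by `ϖ`. -/
theorem C_dvd_setZeroPoly_Phi_iterate [Fact p.Prime] {c : R} (hc : B.ϖ ∣ c) (r : ℕ) (a : ι)
    (i : ℕ) :
    MvPolynomial.C B.ϖ ∣ setZeroPoly r ((Phi B c)^[i] (MvPolynomial.X (a, 0))) := by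
  induction i with
  | zero => simp [setZeroPoly, tailVar]
  | succ i ih =>
    rw [Function.iterate_succ_apply', Phi_eq B hc, map_add, map_pow, map_mul]
    refine dvd_add (dvd_pow ih (Fact.out : p.Prime).ne_zero) (Dvd.dvd.mul_right ?_ _)
    simp [setZeroPoly]

/-- The polynomial `φ^i(T)|_{T = 0} / ϖ` in `δT, …, δ^r T`. -/
def phiQuot [Fact p.Prime] (r i : ℕ) (a : ι) : MvPolynomial (ι × Fin r) R :=
  (C_dvd_setZeroPoly_Phi_iterate B (dvd_refl B.ϖ) r a i).choose

theorem C_mul_phiQuot [Fact p.Prime] (r i : ℕ) (a : ι) :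
    MvPolynomial.C B.ϖ * phiQuot B r i a
      = setZeroPoly r ((Phi B B.ϖ)^[i] (MvPolynomial.X (a, 0))) :=
  (C_dvd_setZeroPoly_Phi_iterate B (dvd_refl B.ϖ) r a i).choose_spec.symm

theorem constantCoeff_phiQuot [Fact p.Prime] [IsDomain R] (r i : ℕ) (a : ι) :
    MvPolynomial.constantCoeff (phiQuot B r i a) = 0 := by
  have h := congrArg MvPolynomial.constantCoeff (C_mul_phiQuot B r i a)
  rw [map_mul, constantCoeff_setZeroPoly, constantCoeff_Phi_iterate_X,
    MvPolynomial.constantCoeff_C] at h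
  exact (mul_eq_zero.1 h).resolve_left B.ϖ_ne_zero

end Polynomials

/-! ## The comparison map on Frobenius powers -/

section Comparison

theorem map_aeval_eq {σ τ A B : Type*} [CommRing A] [CommRing B] (f : A →+* B)
    (w : τ → MvPolynomial σ A) (y : MvPolynomial τ A) :
    MvPolynomial.map f (MvPolynomial.aeval w y)
      = MvPolynomial.aeval (fun s => MvPolynomial.map f (w s)) (MvPolynomial.map f y) := by
  induction y using MvPolynomial.induction_on with
  | C a => simp
  | add x y hx hy => simp only [map_add, hx, hy]
  | mul_X x s hx => simp only [map_mul, hx, MvPolynomial.aeval_X, MvPolynomial.map_X]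

theorem liftCompletion_algebraMap (p : ℕ) {A E : Type*} [CommRing A] [CommRing E]
    [IsAdicComplete (Ideal.span {(p : E)}) E] (f : A →+* E) (a : A) :
    liftCompletion p f (algebraMap A _ a) = f a := by
  refine (IsHausdorff.eq_iff_smodEq (I := Ideal.span {(p : E)})).2 fun n => ?_
  rw [smul_eq_mul, Ideal.mul_top, SModEq, Ideal.Quotient.mk_eq_mk, Ideal.Quotient.mk_eq_mk,
    liftCompletion]
  -- The compatibility proof buried in `liftCompletion` needs a name before `mk_liftRingHom` can be
  -- applied.
  generalize_proofs
  rename_i hf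
  rw [IsAdicComplete.mk_liftRingHom _ _ (fun {m n} h => hf h)]
  simp only [AlgHom.toRingHom_eq_coe, RingHom.comp_apply, RingHom.coe_coe]
  have : AdicCompletion.evalₐ (Ideal.span {(p : A)}) n (algebraMap A _ a)
      = Ideal.Quotient.mk _ a := by
    rw [AlgHom.commutes]
    rfl
  rw [this, Ideal.quotientMap_mk]

variable {p : ℕ} [Fact p.Prime] (S : Type u) [CommRing S] [Algebra (Rp p) S]
  (P : EisensteinPoly p)

/-- By `delta_map`, δ_π is (p/π) δ_p on polynomials coming from R_p, and π · (p/π) = p. So π δ_π and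
p δ_p agree there. -/
theorem Phi_map {ι : Type*} (f : MvPolynomial (ι × ℕ) (Rp p)) :
    Phi (basePi P) (p : Rpi P) (MvPolynomial.map (algebraMap (Rp p) (Rpi P)) f)
      = MvPolynomial.map (algebraMap (Rp p) (Rpi P)) (Phi (baseP p) (baseP p).ϖ f) := by
  have hd : MvPolynomial.C (basePi P).ϖ * MvPolynomial.C (pDivPi P)
      = ((MvPolynomial.C (p : Rpi P)) : MvPolynomial (ι × ℕ) (Rpi P)) := by
    rw [← map_mul]
    exact congrArg _ (piR_mul_pDivPi P)
  rw [Phi_eq (basePi P) (basePi P).dvd_p, delta_map, Phi_eq (baseP p) dvd_rfl, map_add, map_pow,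
    map_mul, ← mul_assoc, hd]
  simp [baseP]

/-- The substitution changes the derivations but not the Frobenius: φ^i(T) in δ_π coordinates
becomes φ^i(T) in δ_p coordinates. -/
theorem subPi_Phi_iterate_X {ι : Type*} (a : ι) (i : ℕ) :
    subPi P ((Phi (basePi P) (basePi P).ϖ)^[i] (MvPolynomial.X (a, 0)))
      = MvPolynomial.map (algebraMap (Rp p) (Rpi P))
        ((Phi (baseP p) (baseP p).ϖ)^[i] (MvPolynomial.X (a, 0))) := by
  induction i with
  | zero => simp [subPi, deltaPiVar]
  | succ i ih =>
    rw [Function.iterate_succ_apply', Function.iterate_succ_apply', subPi_Phi, ih, Phi_map]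

/-- The projection `R_π[x_a, δ_π x_a, … : a ∈ S] → S^r_π` (for polynomials of order `≤ r`). -/
def toSpi (r : ℕ) : MvPolynomial (S × ℕ) (Rpi P) →+* Spi S P r :=
  (algebraMap (JetPi S P r) (Spi S P r)).comp (toJet (basePi P) (relPi S P) r).toRingHom

theorem tra_algebraMap_jet (r : ℕ) (x : JetPi S P r) :
    tra S P r (algebraMap _ _ x) = (Algebra.TensorProduct.map (AlgHom.id (Rp p) (Rpi P))
      (Algebra.ofId (JetP p S r) (Sp p S r) |>.restrictScalars (Rp p))) (comparison S P r x) := by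
  rw [tra, liftCompletion_algebraMap]
  rfl

theorem tra_algebraMap (r : ℕ) (c : Rpi P) :
    tra S P r (algebraMap (Rpi P) (Spi S P r) c) = algebraMap (Rpi P) (SpTensor S P r) c := by
  have h : algebraMap (Rpi P) (Spi S P r) c
      = algebraMap (JetPi S P r) (Spi S P r) (algebraMap (Rpi P) (JetPi S P r) c) := rfl
  rw [h, tra_algebraMap_jet, AlgHom.commutes, Algebra.TensorProduct.algebraMap_apply,
    Algebra.TensorProduct.algebraMap_apply, Algebra.TensorProduct.map_tmul, map_one]
  rfl

/-- The comparison map sends `φ^i(a)` to `1 ⊗ φ^i(a)`. -/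
theorem tra_Phi_iterate_X {i r : ℕ} (hi : i ≤ r) (a : S) :
    tra S P r (toSpi S P r ((Phi (basePi P) (basePi P).ϖ)^[i] (MvPolynomial.X (a, 0))))
      = inclTensor S P r (toSp S r ((Phi (baseP p) (baseP p).ϖ)^[i] (MvPolynomial.X (a, 0)))) := by
  have hs := Phi_iterate_X_supported (basePi P) (dvd_refl (basePi P).ϖ) a hi
  have hc : comparison S P r (toJet (basePi P) (relPi S P) r
      ((Phi (basePi P) (basePi P).ϖ)^[i] (MvPolynomial.X (a, 0))))
      = comparisonPre S P r (truncOrder r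
        ((Phi (basePi P) (basePi P).ϖ)^[i] (MvPolynomial.X (a, 0)))) := rfl
  rw [toSpi, RingHom.comp_apply, tra_algebraMap_jet]
  change (Algebra.TensorProduct.map _ _) (comparison S P r (toJet (basePi P) (relPi S P) r _)) = _
  rw [hc, comparisonPre_trunc S P r hs, subPi_Phi_iterate_X, evalTensor_map,
    Algebra.TensorProduct.map_tmul]
  rfl

theorem phiSp_apply (r : ℕ) (a : S) :
    phiSp p S r a = toSp S r ((Phi (baseP p) (baseP p).ϖ)^[r] (MvPolynomial.X (a, 0))) := by
  suffices h : phiJet p S r a = toJet (baseP p) (relP p S) r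
      ((Phi (baseP p) (baseP p).ϖ)^[r] (MvPolynomial.X (a, 0))) from
    congrArg (algebraMap (JetP p S r) (Sp p S r)) h
  -- `phiJet` is defined by descent along the tautological presentation, so it is evaluated on `a`
  -- written as the image of its own variable.
  have h : a = (MvPolynomial.aeval (R := Rp p) (id : S → S)).toRingHom (MvPolynomial.X a) := by
    simp
  conv_lhs => rw [h]
  rw [phiJet, RingHom.liftOfRightInverse_comp_apply]
  simp [emb, RingHom.coe_pow]

theorem inclTensor_algebraMap (r : ℕ) (c : Rp p) :
    inclTensor S P r (algebraMap (Rp p) (Sp p S r) c)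
      = algebraMap (Rpi P) (SpTensor S P r) (algebraMap (Rp p) (Rpi P) c) := by
  rw [← IsScalarTower.algebraMap_apply]
  exact AlgHom.commutes (Algebra.TensorProduct.includeRight : Sp p S r →ₐ[Rp p] _) c

/-- The substitution `δ_π^i T ↦ {δ_π^i T}|_{T = 0}`. -/
def subPiT (r : ℕ) {J : Type*} :
    MvPolynomial (J × Fin r) (Rpi P) →ₐ[Rpi P] MvPolynomial (J × Fin r) (Rpi P) :=
  MvPolynomial.aeval fun s => setZeroPoly r (deltaPiVar P s.1 (s.2 + 1))

/-- The substitution fixes T itself, so it can be made before or after setting T = 0. The bound on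
the order is essential: `setZeroPoly r` kills the variable of order `r + 1`, whereas its substituted
polynomial also involves lower variables and need not vanish. -/
theorem subPiT_setZeroPoly (r : ℕ) {J : Type*} {y : MvPolynomial (J × ℕ) (Rpi P)}
    (hy : y ∈ MvPolynomial.supported (Rpi P) {s : J × ℕ | s.2 ≤ r}) :
    subPiT P r (setZeroPoly r y) = setZeroPoly r (subPi P y) := by
  rw [MvPolynomial.supported] at hy
  induction hy using Algebra.adjoin_induction with
  | mem x hx =>
    obtain ⟨⟨j, _ | i⟩, hs, rfl⟩ := hx
    · simp [setZeroPoly, tailVar, subPi, deltaPiVar]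
    · have hi : i < r := hs
      simp only [setZeroPoly, MvPolynomial.aeval_X, tailVar, dif_pos hi, subPiT, subPi]
  | algebraMap c => simp only [AlgHom.commutes]
  | add x y _ _ hx hy => simp only [map_add, hx, hy]
  | mul x y _ _ hx hy => simp only [map_mul, hx, hy]

theorem constantCoeff_subPiT (r : ℕ) {J : Type*} (y : MvPolynomial (J × Fin r) (Rpi P)) :
    MvPolynomial.constantCoeff (subPiT P r y) = MvPolynomial.constantCoeff y := by
  have : (MvPolynomial.constantCoeff).comp (subPiT P r (J := J)).toRingHom
      = MvPolynomial.constantCoeff := by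
    apply MvPolynomial.ringHom_ext
    · intro a
      simp [subPiT]
    · intro s
      have h := constantCoeff_delta_iterate (basePi P) (basePi P).dvd_p (s.1, 0) (s.2 + 1)
      simp only [AlgHom.toRingHom_eq_coe, RingHom.comp_apply, RingHom.coe_coe, subPiT,
        MvPolynomial.aeval_X, constantCoeff_setZeroPoly, MvPolynomial.constantCoeff_X]
      exact h
  exact congrArg (fun g => g y) this

/-- The natural homomorphism on a substitution of polynomials over `R_π`. -/
theorem natHom_subst (r : ℕ) {J K : Type*} [Finite J] [Finite K]
    {w : K → MvPolynomial (J × Fin r) (Rpi P)}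
    (hw : ∀ k, MvPolynomial.constantCoeff (w k) = 0) (g : MvPowerSeries K (Spi S P r)) :
    natHom S P r J (g.subst fun k => (MvPolynomial.map (algebraMap (Rpi P) (Spi S P r)) (w k) :
        MvPowerSeries (J × Fin r) (Spi S P r)))
      = (g.map (tra S P r)).subst fun k =>
        (MvPolynomial.map (algebraMap (Rpi P) (SpTensor S P r)) (subPiT P r (w k)) :
          MvPowerSeries (J × Fin r) (SpTensor S P r)) := by
  have h1 : MvPowerSeries.HasSubst fun k =>
      (MvPolynomial.map (algebraMap (Rpi P) (Spi S P r)) (w k) :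
        MvPowerSeries (J × Fin r) (Spi S P r)) :=
    hasSubst_coe fun k => by simp [MvPolynomial.constantCoeff_map, hw]
  have h2 : MvPowerSeries.HasSubst fun k =>
      (MvPolynomial.map (algebraMap (Rpi P) (SpTensor S P r)) (w k) :
        MvPowerSeries (J × Fin r) (SpTensor S P r)) :=
    hasSubst_coe fun k => by simp [MvPolynomial.constantCoeff_map, hw]
  -- The polynomials being substituted have coefficients in R_π, over which `tra` is linear.
  have h3 : (tra S P r).comp (algebraMap (Rpi P) (Spi S P r))
      = algebraMap (Rpi P) (SpTensor S P r) := RingHom.ext (tra_algebraMap S P r)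
  rw [natHom, RingHom.comp_apply, MvPowerSeries.map_subst h1]
  simp only [map_coe, MvPolynomial.map_map, h3]
  change MvPowerSeries.substAlgHom (hasSubst_deltaPiT S P r (J := J)) _ = _
  rw [MvPowerSeries.substAlgHom_apply,
    MvPowerSeries.subst_comp_subst_apply h2 (hasSubst_deltaPiT S P r)]
  congr 1
  funext k
  unfold deltaPiT
  rw [subst_coe_coe]
  congr 1
  rw [subPiT, map_aeval_eq]

end Comparison

/-! ## Arithmetic of `R_π` -/

section Arithmetic

variable {p : ℕ} [Fact p.Prime] (P : EisensteinPoly p)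

theorem coeff_polyR_dvd {i : ℕ} (hi : i < P.poly.natDegree) : (p : Rp p) ∣ P.polyR.coeff i := by
  obtain ⟨y, hy⟩ := Ideal.mem_span_singleton.1 (P.eisenstein.mem hi)
  exact ⟨fromZp p y, by rw [EisensteinPoly.polyR, Polynomial.coeff_map, hy, map_mul, map_natCast]⟩

theorem natDegree_polyR : P.polyR.natDegree = P.poly.natDegree := P.monic.natDegree_map _

theorem piR_pow_natDegree_eq :
    piR P ^ P.poly.natDegree
      = - ∑ i ∈ Finset.range P.poly.natDegree,
        AdjoinRoot.of P.polyR (P.polyR.coeff i) * piR P ^ i := by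
  have h : Polynomial.eval₂ (AdjoinRoot.of P.polyR) (piR P) P.polyR = 0 :=
    AdjoinRoot.eval₂_root _
  rw [Polynomial.eval₂_eq_sum_range, Finset.sum_range_succ, P.polyR_monic.coeff_natDegree,
    map_one, one_mul, natDegree_polyR] at h
  exact eq_neg_of_add_eq_zero_right h

theorem p_dvd_piR_pow : (p : Rpi P) ∣ piR P ^ P.poly.natDegree := by
  rw [piR_pow_natDegree_eq, dvd_neg]
  refine Finset.dvd_sum fun i hi => Dvd.dvd.mul_right ?_ _
  have := map_dvd (AdjoinRoot.of P.polyR) (coeff_polyR_dvd P (Finset.mem_range.1 hi))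
  simpa using this

theorem exists_isUnit_coeff_zero :
    ∃ y : Rp p, IsUnit y ∧ P.polyR.coeff 0 = p * y := by
  have h0 : P.poly.coeff 0 ∈ Ideal.span {(p : ℤ_[p])} :=
    P.eisenstein.mem (by have := P.two_le; omega)
  obtain ⟨y, hy⟩ := Ideal.mem_span_singleton.1 h0
  refine ⟨fromZp p y, IsUnit.map (fromZp p) ?_, ?_⟩
  · by_contra hcon
    have hmem : y ∈ IsLocalRing.maximalIdeal ℤ_[p] := hcon
    rw [PadicInt.maximalIdeal_eq_span_p, Ideal.mem_span_singleton] at hmem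
    apply P.eisenstein.notMem
    rw [hy, Ideal.span_singleton_pow, Ideal.mem_span_singleton, pow_two]
    exact mul_dvd_mul_left _ hmem
  · rw [EisensteinPoly.polyR, Polynomial.coeff_map, hy, map_mul, map_natCast]

/-- In the Eisenstein equation p · unit = -(π^e + ∑_{0<i<e} c_i π^i), every c_i is a multiple of p.
If π^k ∣ p with k < e, then each term on the right is divisible by π^{k+1}. With `p_dvd_piR_pow`, p
and π^e are associates. -/
theorem piR_pow_dvd_p : piR P ^ P.poly.natDegree ∣ (p : Rpi P) := by
  suffices h : ∀ k ≤ P.poly.natDegree, piR P ^ k ∣ (p : Rpi P) from h _ le_rfl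
  intro k
  induction k with
  | zero => simp
  | succ k ih =>
    intro hk
    have hpk := ih (by omega)
    obtain ⟨y, hy, hy0⟩ := exists_isUnit_coeff_zero P
    obtain ⟨m, hm⟩ : ∃ m, P.poly.natDegree = m + 1 := ⟨_, (Nat.sub_add_cancel (by omega)).symm⟩
    have h := piR_pow_natDegree_eq P
    rw [hm, Finset.sum_range_succ', pow_zero, mul_one, hy0, map_mul, map_natCast] at h
    have h' : (p : Rpi P) * AdjoinRoot.of P.polyR y = -(piR P ^ (m + 1)
        + ∑ i ∈ Finset.range m, AdjoinRoot.of P.polyR (P.polyR.coeff (i + 1))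
          * piR P ^ (i + 1)) := by
      rw [h]; ring
    rw [← (hy.map (AdjoinRoot.of P.polyR)).dvd_mul_right, h', dvd_neg]
    refine dvd_add (pow_dvd_pow _ (by omega)) (Finset.dvd_sum fun i hi => ?_)
    rw [pow_succ (piR P) k]
    refine mul_dvd_mul (hpk.trans ?_) (dvd_pow_self _ i.succ_ne_zero)
    have := map_dvd (AdjoinRoot.of P.polyR) (coeff_polyR_dvd P (i := i + 1)
      (by have := Finset.mem_range.1 hi; omega))
    simpa using this

/-- Modulo p the constant coefficient vanishes, so π ↦ 0 defines a homomorphism from R_π to the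
residue field. -/
theorem not_isUnit_piR : ¬ IsUnit (piR P) := by
  have hev : P.polyR.eval₂ (WittVector.constantCoeff (p := p) (R := AlgebraicClosure (ZMod p))) 0
      = 0 := by
    rw [Polynomial.eval₂_at_zero]
    obtain ⟨y, -, hy⟩ := exists_isUnit_coeff_zero P
    rw [hy, map_mul, map_natCast, CharP.cast_eq_zero, zero_mul]
  intro h
  have := h.map (AdjoinRoot.lift (WittVector.constantCoeff (p := p)) 0 hev)
  rw [piR, AdjoinRoot.lift_root] at this
  exact not_isUnit_zero this

theorem natDegree_le_of_vp (h : 1 / ((p : ℚ) - 1) ≤ vp P (piR P)) :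
    P.poly.natDegree ≤ p - 1 := by
  have hp := (Fact.out : p.Prime).two_le
  -- If π^{e+1} ∣ p, then p ∣ π^e would make π a unit. Without finiteness `multiplicity` would be a
  -- default value and carry no information.
  have hfin : FiniteMultiplicity (piR P) (p : Rpi P) := by
    refine ⟨P.poly.natDegree, fun hd => not_isUnit_piR P ?_⟩
    have h1 := hd.trans (p_dvd_piR_pow P)
    rw [pow_succ] at h1
    nth_rw 2 [← mul_one (piR P ^ P.poly.natDegree)] at h1
    exact isUnit_of_dvd_one
      ((mul_dvd_mul_iff_left (pow_ne_zero _ (piR_ne_zero P))).1 h1)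
  have hle : P.poly.natDegree ≤ multiplicity (piR P) (p : Rpi P) :=
    hfin.le_multiplicity_of_pow_dvd (piR_pow_dvd_p P)
  refine hle.trans ?_
  have h2 := P.two_le
  have hpos : (0 : ℚ) < multiplicity (piR P) (p : Rpi P) := by
    exact_mod_cast (by omega : 0 < multiplicity (piR P) (p : Rpi P))
  have hp1 : (0 : ℚ) < (p : ℚ) - 1 := by
    have : (2 : ℚ) ≤ p := by exact_mod_cast hp
    linarith
  rw [vp, multiplicity_self, Nat.cast_one, one_div_le_one_div hp1 hpos] at h
  have : ((multiplicity (piR P) (p : Rpi P) : ℕ) : ℚ) ≤ ((p - 1 : ℕ) : ℚ) := by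
    rw [Nat.cast_sub (by omega)]
    simpa using h
  exact_mod_cast this

theorem isUnit_natCast_Rpi {m : ℕ} (hm : ¬ p ∣ m) : IsUnit (m : Rpi P) := by
  have h : IsUnit (m : ℤ_[p]) := by
    rw [PadicInt.isUnit_iff]
    exact PadicInt.norm_natCast_eq_one_iff.2 ((Fact.out : p.Prime).coprime_iff_not_dvd.2 hm)
  simpa using h.map ((AdjoinRoot.of P.polyR).comp (fromZp p))

/-- This is the estimate that makes π^{n-1}/n divisible by p^M for large n; M = 0 is plain
integrality. Put q = p - 1. For M < k = j + 1, split p^k = (q+1)^j q + (q+1)^j: the first term is at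
least kq, the second at least 1 + jq ≥ 1 + Mq. For k ≤ M, (k + M) q ≤ 2Mq < n. -/
theorem mul_add_le_pred_of_pow_dvd {n k M : ℕ} (hn : n ≠ 0) (hk : p ^ k ∣ n) (hM : 2 * M * (p - 1) < n) :
    (p - 1) * (k + M) ≤ n - 1 := by
  have hp := (Fact.out : p.Prime).two_le
  have hle : p ^ k ≤ n := Nat.le_of_dvd (Nat.pos_of_ne_zero hn) hk
  obtain ⟨q, rfl⟩ : ∃ q, p = q + 1 := ⟨p - 1, by omega⟩
  simp only [Nat.add_sub_cancel] at *
  rcases Nat.lt_or_ge M k with h | h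
  · refine le_trans ?_ (Nat.sub_le_sub_right hle 1)
    obtain ⟨j, rfl⟩ : ∃ j, k = j + 1 := ⟨k - 1, by omega⟩
    have h1 : 1 + j * q ≤ (q + 1) ^ j := by
      have := one_add_mul_le_pow (a := (q : ℤ)) (by omega) j
      rw [add_comm q 1]
      exact_mod_cast this
    have h2 : j + 1 ≤ (q + 1) ^ j := (Nat.lt_pow_self (by omega)).nat_succ_le
    have : (q + 1) ^ (j + 1) = (q + 1) ^ j * q + (q + 1) ^ j := by ring
    have h3 : (j + 1) * q ≤ (q + 1) ^ j * q := Nat.mul_le_mul_right _ h2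
    have h4 : q * M ≤ q * j := Nat.mul_le_mul_left _ (by omega)
    have h5 : q * (j + 1 + M) = (j + 1) * q + q * M := by ring
    have h6 : q * j = j * q := by ring
    omega
  · have : q * (k + M) ≤ 2 * M * q := by nlinarith
    omega

theorem exists_mul_eq_piR_pow (hE : P.poly.natDegree ≤ p - 1) {n M : ℕ} (hn : n ≠ 0)
    (hM : 2 * M * (p - 1) < n) : ∃ c : Rpi P, n * ((p : Rpi P) ^ M * c) = piR P ^ (n - 1) := by
  -- With n = p^k m, the factor m is a unit, and π^{n-1} has p^{k+M} as a divisor: p^k cancels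
  -- against n and p^M remains.
  obtain ⟨k, m, hm, rfl⟩ := Nat.exists_eq_pow_mul_and_not_dvd hn p (Fact.out : p.Prime).ne_one
  have h1 : (p : Rpi P) ∣ piR P ^ (p - 1) := (p_dvd_piR_pow P).trans (pow_dvd_pow _ hE)
  have h2 : (p : Rpi P) ^ (k + M) ∣ piR P ^ (p ^ k * m - 1) := by
    refine (pow_dvd_pow_of_dvd h1 (k + M)).trans ?_
    rw [← pow_mul]
    exact pow_dvd_pow _ (mul_add_le_pred_of_pow_dvd hn (Dvd.intro _ rfl) hM)
  obtain ⟨c, hc⟩ := h2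
  obtain ⟨u, hu⟩ := isUnit_natCast_Rpi P hm
  refine ⟨(↑u⁻¹ : Rpi P) * c, ?_⟩
  have hu1 : (m : Rpi P) * (↑u⁻¹ : Rpi P) = 1 := by rw [← hu, Units.mul_inv]
  rw [hc, Nat.cast_mul, Nat.cast_pow]
  linear_combination (p : Rpi P) ^ (k + M) * c * hu1

end Arithmetic

/-! ## Frobenius powers of power series -/

section Series

theorem map_subst_coe {K σ A B : Type*} [Finite K] [CommRing A] [CommRing B] {f : A →+* B}
    {w : K → MvPolynomial σ A} (hw : ∀ k, MvPolynomial.constantCoeff (w k) = 0)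
    (g : MvPowerSeries K A) :
    (g.subst fun k => (w k : MvPowerSeries σ A)).map f
      = (g.map f).subst fun k => (MvPolynomial.map f (w k) : MvPowerSeries σ B) := by
  rw [MvPowerSeries.map_subst (hasSubst_coe hw)]
  simp only [map_coe]

/-- There are infinitely many variables, so vanishing constant terms do not suffice. Substitution is
allowed because `J` is finite and all variables of order above `r` go to 0. -/
theorem hasSubst_tailVar (r : ℕ) {J R : Type*} [Finite J] [CommRing R] :
    MvPowerSeries.HasSubst fun s : J × ℕ =>
      ((tailVar r s : MvPolynomial (J × Fin r) R) : MvPowerSeries (J × Fin r) R) where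
  const_coeff := by
    rintro ⟨j, _ | i⟩
    · simp [tailVar]
    · simp only [tailVar]
      split_ifs <;> simp
  coeff_zero d := by
    refine (Set.finite_univ.prod (Set.finite_Iic r)).subset ?_
    rintro ⟨j, _ | i⟩ hs
    · simp
    · by_contra h
      refine hs ?_
      have : ¬ i < r := by simpa using h
      simp [tailVar, this]

theorem setZero_coe {J R : Type*} [CommRing R] (r : ℕ) (y : MvPolynomial (J × ℕ) R) :
    setZero r (y : MvPowerSeries (J × ℕ) R) = (setZeroPoly r y : MvPolynomial (J × Fin r) R) := by
  rw [setZero, subst_coe_coe, setZeroPoly]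

/-- Setting `T = 0` in a substitution. -/
theorem setZero_subst {J K R : Type*} [Finite J] [Finite K] [CommRing R] (r : ℕ)
    {w : K → MvPolynomial (J × ℕ) R} (hw : ∀ k, MvPolynomial.constantCoeff (w k) = 0)
    (g : MvPowerSeries K R) :
    setZero r (g.subst fun k => (w k : MvPowerSeries (J × ℕ) R))
      = g.subst fun k => (setZeroPoly r (w k) : MvPowerSeries (J × Fin r) R) := by
  rw [setZero, MvPowerSeries.subst_comp_subst_apply (hasSubst_coe hw) (hasSubst_tailVar r)]
  congr 1
  funext k
  exact setZero_coe r (w k)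

theorem map_setZero_subst {J K R A D : Type*} [Finite J] [Finite K] [CommRing R] [CommRing A]
    [CommRing D] (r : ℕ) {w : K → MvPolynomial (J × ℕ) R}
    (hw : ∀ k, MvPolynomial.constantCoeff (w k) = 0) (c : R →+* A) (h : A →+* D)
    (a : (K →₀ ℕ) → A) :
    (setZero r ((ofCoeff a).subst fun k =>
        (MvPolynomial.map c (w k) : MvPowerSeries (J × ℕ) A))).map h
      = (ofCoeff fun d => h (a d)).subst fun k =>
        (MvPolynomial.map (h.comp c) (setZeroPoly r (w k)) : MvPowerSeries (J × Fin r) D) := by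
  rw [setZero_subst r fun k => by rw [MvPolynomial.constantCoeff_map, hw, map_zero],
    map_subst_coe fun k => by
      rw [constantCoeff_setZeroPoly, MvPolynomial.constantCoeff_map, hw, map_zero], map_ofCoeff]
  simp only [← setZeroPoly_map, MvPolynomial.map_map]

/-- The polynomials `w` live over a base ring `R`, so T = 0 can be set there once and for all, while
the changes of coefficients act on `a` and through the structure map `c`. -/
theorem map_setZero_map_subst {J K R A B D : Type*} [Finite J] [Finite K] [CommRing R] [CommRing A]
    [CommRing B] [CommRing D] (r : ℕ) {w : K → MvPolynomial (J × ℕ) R}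
    (hw : ∀ k, MvPolynomial.constantCoeff (w k) = 0) (c : R →+* A) (f : A →+* B) (h : B →+* D)
    (a : (K →₀ ℕ) → A) :
    (setZero r (((ofCoeff a).subst fun k =>
        (MvPolynomial.map c (w k) : MvPowerSeries (J × ℕ) A)).map f)).map h
      = (ofCoeff fun d => h (f (a d))).subst fun k =>
        (MvPolynomial.map (h.comp (f.comp c)) (setZeroPoly r (w k)) :
          MvPowerSeries (J × Fin r) D) := by
  rw [map_subst_coe fun k => by rw [MvPolynomial.constantCoeff_map, hw, map_zero], map_ofCoeff]
  simp only [MvPolynomial.map_map]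
  exact map_setZero_subst r hw _ _ _

variable {p : ℕ} [Fact p.Prime] {S : Type u}

/-- A polynomial over `R_p`, viewed over `R_p[x_a, δ_p x_a, … : a ∈ S]`. -/
abbrev liftPoly (S : Type u) {σ : Type*} (y : MvPolynomial σ (Rp p)) :
    MvPolynomial σ (MvPolynomial (S × ℕ) (Rp p)) :=
  MvPolynomial.map MvPolynomial.C y

/-- `PhiSeries` as a ring homomorphism. -/
def phiSeriesHom (p : ℕ) [Fact p.Prime] (J : Type*) (S : Type u) :
    MvPowerSeries (J × ℕ) (MvPolynomial (S × ℕ) (Rp p)) →+*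
      MvPowerSeries (J × ℕ) (MvPolynomial (S × ℕ) (Rp p)) :=
  (MvPowerSeries.substAlgHom (R := MvPolynomial (S × ℕ) (Rp p))
    (hasSubst_PhiSeries (p := p) (J := J))).toRingHom.comp
      (MvPowerSeries.map (Phi (baseP p) (baseP p).ϖ))

theorem phiSeriesHom_apply {J : Type*} (f : MvPowerSeries (J × ℕ) (MvPolynomial (S × ℕ) (Rp p))) :
    phiSeriesHom p J S f = PhiSeries f := by
  rw [phiSeriesHom, RingHom.comp_apply]
  change MvPowerSeries.substAlgHom _ _ = _
  rw [MvPowerSeries.substAlgHom_apply, PhiSeries]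

/-- Two ring homomorphisms on R_p[T, δT, …] are compared on constants and variables; for this
`PhiSeries` is used in its bundled form. -/
theorem PhiSeries_coe {J : Type*} (y : MvPolynomial (J × ℕ) (Rp p)) :
    PhiSeries (liftPoly S y : MvPowerSeries (J × ℕ) (MvPolynomial (S × ℕ) (Rp p)))
      = (liftPoly S (Phi (baseP p) (baseP p).ϖ y) :
        MvPowerSeries (J × ℕ) (MvPolynomial (S × ℕ) (Rp p))) := by
  let κ : MvPolynomial (J × ℕ) (Rp p) →+*
      MvPowerSeries (J × ℕ) (MvPolynomial (S × ℕ) (Rp p)) :=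
    MvPolynomial.coeToMvPowerSeries.ringHom.comp (MvPolynomial.map MvPolynomial.C)
  have : (phiSeriesHom p J S).comp κ = κ.comp (Phi (baseP p) (baseP p).ϖ) := by
    apply MvPolynomial.ringHom_ext
    · intro a
      simp only [RingHom.comp_apply, phiSeriesHom_apply, κ, MvPolynomial.map_C,
        MvPolynomial.coeToMvPowerSeries.ringHom_apply, MvPolynomial.coe_C, PhiSeries,
        MvPowerSeries.map_C, MvPowerSeries.subst_C]
      simp [Phi]
    · intro s
      simp only [RingHom.comp_apply, phiSeriesHom_apply, κ, MvPolynomial.map_X,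
        MvPolynomial.coeToMvPowerSeries.ringHom_apply, MvPolynomial.coe_X, PhiSeries,
        MvPowerSeries.map_X, MvPowerSeries.subst_X hasSubst_PhiSeries]
      simp only [Phi, baseP, MvPolynomial.eval₂Hom_X', map_add, map_mul, map_pow, map_natCast,
        MvPolynomial.map_X]
      rw [← MvPolynomial.coeToMvPowerSeries.ringHom_apply, map_add, map_mul, map_pow, map_natCast]
      simp only [MvPolynomial.coeToMvPowerSeries.ringHom_apply, MvPolynomial.coe_X]
  have h := congrArg (fun g => g y) this
  rw [RingHom.comp_apply, phiSeriesHom_apply] at h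
  exact h

theorem PhiSeries_subst {J K : Type*} [Finite K]
    {w : K → MvPolynomial (J × ℕ) (Rp p)} (hw : ∀ k, MvPolynomial.constantCoeff (w k) = 0)
    (g : MvPowerSeries K (MvPolynomial (S × ℕ) (Rp p))) :
    PhiSeries (g.subst fun k => (liftPoly S (w k) :
        MvPowerSeries (J × ℕ) (MvPolynomial (S × ℕ) (Rp p))))
      = (g.map (Phi (baseP p) (baseP p).ϖ)).subst fun k =>
        (liftPoly S (Phi (baseP p) (baseP p).ϖ (w k)) :
          MvPowerSeries (J × ℕ) (MvPolynomial (S × ℕ) (Rp p))) := by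
  have h1 : MvPowerSeries.HasSubst fun k => (liftPoly S (w k) :
      MvPowerSeries (J × ℕ) (MvPolynomial (S × ℕ) (Rp p))) :=
    hasSubst_coe fun k => by simp [MvPolynomial.constantCoeff_map, hw]
  have h2 : MvPowerSeries.HasSubst fun k => (liftPoly S (w k) :
      MvPowerSeries (J × ℕ) (MvPolynomial (S × ℕ) (Rp p))).map (Phi (baseP p) (baseP p).ϖ) := by
    simp only [map_coe]
    exact hasSubst_coe fun k => by simp [MvPolynomial.constantCoeff_map, hw]
  conv_lhs => rw [PhiSeries, MvPowerSeries.map_subst h1,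
    MvPowerSeries.subst_comp_subst_apply h2 hasSubst_PhiSeries]
  congr 1
  funext k
  exact PhiSeries_coe (w k)

/-- φ^i(∑ x_a T^α) = ∑ φ^i(x_a) φ^i(T)^α: by `PhiSeries_subst`, φ acts separately on the
coefficients and on the substituted polynomials. -/
theorem PhiSeries_iterate_liftSeries [CommRing S] {J : Type*} [Finite J] (f : MvPowerSeries J S)
    (i : ℕ) :
    PhiSeries^[i] (liftSeries p f)
      = (ofCoeff fun d => (Phi (baseP p) (baseP p).ϖ)^[i]
          (MvPolynomial.X (MvPowerSeries.coeff d f, 0))).subst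
        fun j => (liftPoly S
          ((Phi (baseP p) (baseP p).ϖ)^[i] (MvPolynomial.X (j, 0))) :
            MvPowerSeries (J × ℕ) (MvPolynomial (S × ℕ) (Rp p))) := by
  induction i with
  | zero => simp [liftSeries, ofCoeff]
  | succ i ih =>
    rw [Function.iterate_succ_apply', ih,
      PhiSeries_subst fun j => constantCoeff_Phi_iterate_X (baseP p) _ _ _, map_ofCoeff]
    simp only [Function.iterate_succ_apply']

theorem toSp_C [CommRing S] [Algebra (Rp p) S] (r : ℕ) :
    (toSp S r).comp MvPolynomial.C = algebraMap (Rp p) (Sp p S r) := by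
  ext1 c
  have h : toJet (baseP p) (relP p S) r (MvPolynomial.C c) = algebraMap (Rp p) (JetP p S r) c :=
    (toJet (baseP p) (relP p S) r).commutes c
  exact congrArg (algebraMap (JetP p S r) (Sp p S r)) h

/-- The ring homomorphism `g ↦ g|_{T = 0}` to series over `R_π ⊗ S^r_p`. -/
def evalZero (S : Type u) [CommRing S] [Algebra (Rp p) S] (P : EisensteinPoly p) (r : ℕ)
    (J : Type*) [Finite J] :
    MvPowerSeries (J × ℕ) (MvPolynomial (S × ℕ) (Rp p)) →+*
      MvPowerSeries (J × Fin r) (SpTensor S P r) :=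
  (MvPowerSeries.map (inclTensor S P r)).comp
    ((MvPowerSeries.substAlgHom (R := Sp p S r) (hasSubst_tailVar r)).toRingHom.comp
      (MvPowerSeries.map (toSp S r)))

theorem evalZero_apply [CommRing S] [Algebra (Rp p) S] (P : EisensteinPoly p) (r : ℕ) {J : Type*}
    [Finite J] (g : MvPowerSeries (J × ℕ) (MvPolynomial (S × ℕ) (Rp p))) :
    evalZero S P r J g = (setZero r (g.map (toSp S r))).map (inclTensor S P r) := by
  rw [evalZero, RingHom.comp_apply, RingHom.comp_apply]
  change MvPowerSeries.map _ (MvPowerSeries.substAlgHom _ _) = _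
  rw [MvPowerSeries.substAlgHom_apply, setZero]

/-- The polynomials are routed through R_π, although they come from R_p, so that the factor π can be
extracted from them later. -/
theorem evalZero_PhiSeries_iterate [CommRing S] [Algebra (Rp p) S] (P : EisensteinPoly p) (r : ℕ)
    {J : Type*} [Finite J] (f : MvPowerSeries J S) (i : ℕ) :
    evalZero S P r J (PhiSeries^[i] (liftSeries p f))
      = (ofCoeff fun d => inclTensor S P r (toSp S r ((Phi (baseP p) (baseP p).ϖ)^[i]
          (MvPolynomial.X (MvPowerSeries.coeff d f, 0))))).subst
        fun j => (MvPolynomial.map (algebraMap (Rpi P) (SpTensor S P r))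
          (MvPolynomial.map (algebraMap (Rp p) (Rpi P)) (setZeroPoly r
            ((Phi (baseP p) (baseP p).ϖ)^[i] (MvPolynomial.X (j, 0))))) :
            MvPowerSeries (J × Fin r) (SpTensor S P r)) := by
  have hinc : (inclTensor S P r).comp ((toSp S r).comp MvPolynomial.C)
      = (algebraMap (Rpi P) (SpTensor S P r)).comp (algebraMap (Rp p) (Rpi P)) := by
    rw [toSp_C]
    exact RingHom.ext (inclTensor_algebraMap S P r)
  rw [PhiSeries_iterate_liftSeries]
  refine (evalZero_apply P r _).trans ?_
  refine (map_setZero_map_subst r (fun j => constantCoeff_Phi_iterate_X (baseP p) _ _ _)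
    MvPolynomial.C (toSp S r) (inclTensor S P r) _).trans ?_
  simp only [hinc, MvPolynomial.map_map]

/-! ## The derivatives in terms of Frobenius powers -/

theorem exists_pow_mul_deltaSeries_mem {J : Type*}
    (f : MvPowerSeries (J × ℕ) (MvPolynomial (S × ℕ) (Rp p))) (r : ℕ) :
    ∃ n, 1 ≤ n ∧ (p : MvPowerSeries (J × ℕ) (MvPolynomial (S × ℕ) (Rp p))) ^ n * deltaSeries^[r] f
      ∈ Subring.closure {g | ∃ i ≤ r, g = PhiSeries^[i] f} := by
  have hp := (Fact.out : p.Prime).one_le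
  induction r with
  | zero =>
    -- Exponent 1 instead of 0 because a positive exponent is required.
    refine ⟨1, le_rfl, mul_mem (pow_mem (natCast_mem _ p) 1) ?_⟩
    exact Subring.subset_closure ⟨0, le_rfl, rfl⟩
  | succ r ih =>
    obtain ⟨n, hn, h⟩ := ih
    set D := deltaSeries^[r] f
    have h1 : (p : MvPowerSeries (J × ℕ) (MvPolynomial (S × ℕ) (Rp p))) ^ n * D
        ∈ Subring.closure {g | ∃ i ≤ r + 1, g = PhiSeries^[i] f} :=
      Subring.closure_mono (by rintro g ⟨i, hi, hg⟩; exact ⟨i, by omega, hg⟩) h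
    have h2 : phiSeriesHom p J S
        ((p : MvPowerSeries (J × ℕ) (MvPolynomial (S × ℕ) (Rp p))) ^ n * D)
        ∈ Subring.closure {g | ∃ i ≤ r + 1, g = PhiSeries^[i] f} := by
      have : Subring.closure {g | ∃ i ≤ r, g = PhiSeries^[i] f}
          ≤ (Subring.closure {g | ∃ i ≤ r + 1, g = PhiSeries^[i] f}).comap
            (phiSeriesHom p J S) := by
        rw [Subring.closure_le]
        rintro _ ⟨i, hi, rfl⟩
        refine Subring.subset_closure ⟨i + 1, by omega, ?_⟩
        rw [phiSeriesHom_apply, Function.iterate_succ_apply']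
      exact this h
    -- Multiply p δ(D) = φ(D) - D^p by p^{np}: then D^p absorbs all of p^{np} to become (p^n D)^p,
    -- while φ(D) takes only p^n and leaves p^{np-n}.
    have h3 : (p : MvPowerSeries (J × ℕ) (MvPolynomial (S × ℕ) (Rp p))) ^ (n * p + 1)
        * deltaSeries D = (p : MvPowerSeries (J × ℕ) (MvPolynomial (S × ℕ) (Rp p))) ^ (n * p - n)
          * phiSeriesHom p J S (p ^ n * D) - (p ^ n * D) ^ p := by
      have hle : n ≤ n * p := Nat.le_mul_of_pos_right n hp
      rw [pow_succ, mul_assoc, deltaSeries_spec, map_mul, map_pow, map_natCast,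
        phiSeriesHom_apply, ← mul_assoc, ← pow_add, Nat.sub_add_cancel hle, mul_pow, ← pow_mul]
      ring
    refine ⟨n * p + 1, by omega, ?_⟩
    rw [Function.iterate_succ_apply', h3]
    exact sub_mem (mul_mem (pow_mem (natCast_mem _ p) _) h2) (pow_mem h1 p)

end Series

/-! ## Series in the image of the natural homomorphism -/

section Image

theorem isRestricted_ofCoeff {p : ℕ} {J A : Type*} [Finite J] [CommRing A] {a : (J →₀ ℕ) → A}
    (h : ∀ m, ∃ N, ∀ d : J →₀ ℕ, N < d.degree → a d ∈ Ideal.span {(p : A) ^ m}) :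
    IsRestricted p (ofCoeff a) := by
  classical
  intro m
  obtain ⟨N, hN⟩ := h m
  -- Every exponent of degree at most `N` lies below the constant exponent `N`, and such a box is
  -- finite as `J` is.
  refine (Set.finite_Iic (Finsupp.equivFunOnFinite.symm fun _ : J => N)).subset fun d hd j => ?_
  have : d.degree ≤ N := by
    by_contra hlt
    exact hd (hN d (not_le.1 hlt))
  simpa using (Finsupp.le_degree j d).trans this

theorem subst_scaled {σ K D : Type*} [Finite K] [CommRing D] {w w' : K → MvPolynomial σ D}
    (hw : ∀ k, MvPolynomial.constantCoeff (w k) = 0) {c : D}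
    (h : ∀ k, w' k = MvPolynomial.C c * w k) (a : (K →₀ ℕ) → D) :
    ((ofCoeff a).subst fun k => (w' k : MvPowerSeries σ D))
      = (ofCoeff fun d => c ^ d.degree * a d).subst fun k => (w k : MvPowerSeries σ D) := by
  refine (subst_C_mul (c := c) (hasSubst_coe hw) (hasSubst_coe fun k => ?_) (fun k => ?_) _).trans ?_
  · rw [h, map_mul, hw, mul_zero]
  · rw [h, MvPolynomial.coe_mul, MvPolynomial.coe_C]
  · simp only [coeff_ofCoeff]

theorem C_mul_smul_subst {σ K D : Type*} [Finite K] [CommRing D] [Algebra ℚ D]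
    {w : K → MvPolynomial σ D} (hw : ∀ k, MvPolynomial.constantCoeff (w k) = 0) (x : D) (q : ℚ)
    (a : (K →₀ ℕ) → D) :
    MvPowerSeries.C x * (q • (ofCoeff a).subst fun k => (w k : MvPowerSeries σ D))
      = (ofCoeff fun d => x * q • a d).subst fun k => (w k : MvPowerSeries σ D) := by
  have h : (ofCoeff fun d => x * q • a d) = (x * algebraMap ℚ D q) • ofCoeff a := by
    ext d
    rw [MvPowerSeries.coeff_smul, coeff_ofCoeff, coeff_ofCoeff, Algebra.smul_def, mul_assoc]
  rw [h, MvPowerSeries.subst_smul (hasSubst_coe hw), MvPowerSeries.smul_eq_C_mul, map_mul,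
    mul_assoc, ← MvPowerSeries.smul_eq_C_mul (a := algebraMap ℚ D q), algebraMap_smul]

variable {p : ℕ} [Fact p.Prime] (S : Type u) [CommRing S] [Algebra (Rp p) S]
  (P : EisensteinPoly p)

/-- Apply the substitution to the defining equation π Q_i = φ^i(T)|_{T=0}: its right side becomes
the same expression in the δ_p variables. So φ^i(T)|_{T=0} / π, and not merely φ^i(T)|_{T=0}, comes
from the δ_π side. -/
theorem C_mul_subPiT_phiQuot {i r : ℕ} (hi : i ≤ r) {J : Type*} (j : J) :
    MvPolynomial.C (piR P) * subPiT P r (phiQuot (basePi P) r i j)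
      = MvPolynomial.map (algebraMap (Rp p) (Rpi P)) (setZeroPoly r
        ((Phi (baseP p) (baseP p).ϖ)^[i] (MvPolynomial.X (j, 0)))) := by
  have h := congrArg (subPiT P r) (C_mul_phiQuot (basePi P) r i j)
  rw [subPiT_setZeroPoly P r (Phi_iterate_X_supported (basePi P) dvd_rfl j hi),
    subPi_Phi_iterate_X, setZeroPoly_map, map_mul, ← MvPolynomial.algebraMap_eq,
    AlgHom.commutes] at h
  exact h

/-- The image under the natural homomorphism of a series in `φ^i(T)|_{T = 0} / π` whose
coefficients are multiples of Frobenius powers of elements of `S`. -/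
theorem natHom_subst_phiQuot {i r : ℕ} (hi : i ≤ r) {J : Type*} [Finite J] (c : (J →₀ ℕ) → Rpi P)
    (a : (J →₀ ℕ) → S) :
    natHom S P r J ((ofCoeff fun d => algebraMap (Rpi P) (Spi S P r) (c d) *
        toSpi S P r ((Phi (basePi P) (basePi P).ϖ)^[i] (MvPolynomial.X (a d, 0)))).subst
          fun j => (MvPolynomial.map (algebraMap (Rpi P) (Spi S P r))
            (phiQuot (basePi P) r i j) : MvPowerSeries (J × Fin r) (Spi S P r)))
      = (ofCoeff fun d => algebraMap (Rpi P) (SpTensor S P r) (c d) *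
        inclTensor S P r (toSp S r ((Phi (baseP p) (baseP p).ϖ)^[i]
          (MvPolynomial.X (a d, 0))))).subst
          fun j => (MvPolynomial.map (algebraMap (Rpi P) (SpTensor S P r))
            (subPiT P r (phiQuot (basePi P) r i j)) :
              MvPowerSeries (J × Fin r) (SpTensor S P r)) := by
  refine (natHom_subst S P r (fun j => constantCoeff_phiQuot (basePi P) r i j) _).trans ?_
  have h : ∀ d, tra S P r (algebraMap (Rpi P) (Spi S P r) (c d) *
      toSpi S P r ((Phi (basePi P) (basePi P).ϖ)^[i] (MvPolynomial.X (a d, 0))))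
      = algebraMap (Rpi P) (SpTensor S P r) (c d) *
        inclTensor S P r (toSp S r ((Phi (baseP p) (baseP p).ϖ)^[i]
          (MvPolynomial.X (a d, 0)))) := fun d => by
    rw [map_mul, tra_algebraMap, tra_Phi_iterate_X S P hi]
  rw [map_ofCoeff]
  simp only [h]

theorem isRestricted_subst_phiQuot {i r : ℕ} {J : Type*} [Finite J] {c : (J →₀ ℕ) → Rpi P}
    (hc : ∀ m, ∃ N, ∀ d : J →₀ ℕ, N < d.degree → (p : Rpi P) ^ m ∣ c d)
    (y : (J →₀ ℕ) → Spi S P r) :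
    IsRestricted p ((ofCoeff fun d => algebraMap (Rpi P) (Spi S P r) (c d) * y d).subst
      fun j => (MvPolynomial.map (algebraMap (Rpi P) (Spi S P r))
        (phiQuot (basePi P) r i j) : MvPowerSeries (J × Fin r) (Spi S P r))) := by
  refine IsRestricted.subst (hasSubst_coe fun j => ?_) (isRestricted_ofCoeff fun m => ?_)
  · rw [MvPolynomial.constantCoeff_map, constantCoeff_phiQuot, map_zero]
  · obtain ⟨N, hN⟩ := hc m
    refine ⟨N, fun d hd => Ideal.mul_mem_right _ _ (Ideal.mem_span_singleton.2 ?_)⟩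
    have := map_dvd (algebraMap (Rpi P) (Spi S P r)) (hN d hd)
    rwa [map_pow, map_natCast] at this

theorem exists_natHom_eq_evalZero {i r : ℕ} (hi : i ≤ r) {J : Type*} [Finite J]
    (f : MvPowerSeries J S) :
    ∃ G, IsRestricted p G ∧
      natHom S P r J G = evalZero S P r J (PhiSeries^[i] (liftSeries p f)) := by
  -- The coefficient π^{|d|} is the factor split off from (π Q_i)^d. As p ∣ π^e, degrees above e · m
  -- give divisibility by p^m.
  refine ⟨_, isRestricted_subst_phiQuot S P (i := i) (c := fun d => piR P ^ d.degree)
    (fun m => ⟨P.poly.natDegree * m, fun d hd => ?_⟩) _,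
    (natHom_subst_phiQuot S P hi _ fun d => MvPowerSeries.coeff d f).trans ?_⟩
  · refine (pow_dvd_pow_of_dvd (p_dvd_piR_pow P) m).trans ?_
    rw [← pow_mul]
    exact pow_dvd_pow _ hd.le
  · refine ((evalZero_PhiSeries_iterate P r f i).trans ?_).symm
    refine (subst_scaled (c := algebraMap (Rpi P) (SpTensor S P r) (piR P))
      (w := fun j => MvPolynomial.map (algebraMap (Rpi P) (SpTensor S P r))
        (subPiT P r (phiQuot (basePi P) r i j))) (fun j => ?_) (fun j => ?_) _).trans ?_
    · rw [MvPolynomial.constantCoeff_map, constantCoeff_subPiT, constantCoeff_phiQuot, map_zero]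
    · rw [← C_mul_subPiT_phiQuot P hi, map_mul, MvPolynomial.map_C]
    · simp only [map_pow]

theorem exists_natHom_eq_pow_mul_jetSeries (r : ℕ) {J : Type*} [Finite J]
    (f : MvPowerSeries J S) :
    ∃ n : ℕ, 1 ≤ n ∧ ∃ G : MvPowerSeries (J × Fin r) (Spi S P r), IsRestricted p G ∧
      natHom S P r J G = (p : MvPowerSeries (J × Fin r) (SpTensor S P r)) ^ n *
        (jetSeries p r f).map (inclTensor S P r) := by
  obtain ⟨n, hn, h⟩ := exists_pow_mul_deltaSeries_mem (liftSeries p f) r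
  -- The series that `evalZero` sends into the image of the restricted series form a subring, so
  -- only the generators φ^i(f) need checking.
  have hle : Subring.closure {g | ∃ i ≤ r, g = PhiSeries^[i] (liftSeries p f)}
      ≤ ((restrictedSubring p (J × Fin r) (Spi S P r)).map (natHom S P r J)).comap
        (evalZero S P r J) := by
    rw [Subring.closure_le]
    rintro _ ⟨i, hi, rfl⟩
    exact exists_natHom_eq_evalZero S P hi f
  obtain ⟨G, hG, hG'⟩ := hle h
  refine ⟨n, hn, G, hG, hG'.trans ?_⟩
  rw [map_mul, map_pow, map_natCast]
  exact congrArg _ (evalZero_apply P r _)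

end Image

/-! ## The logarithm -/

section Logarithm

theorem ratMap_toRat {A B : Type*} [CommRing A] [CommRing B] (f : A →+* B) (a : A) :
    ratMap f (toRat A a) = toRat B (f a) :=
  Algebra.TensorProduct.map_tmul (AlgHom.id ℤ ℚ) f.toIntAlgHom 1 a

theorem map_ratMap_smul {σ A B : Type*} [CommRing A] [CommRing B] (f : A →+* B) (q : ℚ)
    (g : MvPowerSeries σ (RatTensor A)) : (q • g).map (ratMap f) = q • g.map (ratMap f) :=
  map_rat_smul _ q g

variable {p : ℕ} [Fact p.Prime] {S : Type u} [CommRing S] [Algebra (Rp p) S]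
  (P : EisensteinPoly p)

/-- The coefficients of the invariant differential `dT / (∂F/∂X)(0, T)` of a formal group law. -/
def diffCoeff (F : FormalGroup S) (n : ℕ) : S :=
  PowerSeries.coeff n (PowerSeries.invOfUnit (PowerSeries.mk fun k =>
    MvPowerSeries.coeff (Finsupp.single 0 1 + Finsupp.single 1 k) F.toPowerSeries) 1)

/-- This puts the logarithm in the form used by the substitution lemmas. The constant coefficient is
0 because 1 / 0 = 0 in ℚ. -/
theorem formalLog_map {A : Type*} [CommRing A] (F : FormalGroup S) (f : S →+* A) :
    (formalLog F).map (ratMap f) = (ofCoeff fun d : Unit →₀ ℕ =>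
      (1 / (d ()) : ℚ) • toRat A (f (diffCoeff F (d () - 1))) :
        MvPowerSeries Unit (RatTensor A)) := by
  refine PowerSeries.ext fun n => ?_
  rw [PowerSeries.coeff_map, formalLog, PowerSeries.coeff_mk, map_rat_smul, ratMap_toRat]
  have : PowerSeries.coeff n (ofCoeff fun d : Unit →₀ ℕ =>
      (1 / (d ()) : ℚ) • toRat A (f (diffCoeff F (d () - 1))) : MvPowerSeries Unit (RatTensor A))
      = (1 / ((Finsupp.single () n : Unit →₀ ℕ) ()) : ℚ) •
        toRat A (f (diffCoeff F ((Finsupp.single () n : Unit →₀ ℕ) () - 1))) := rfl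
  rw [this, Finsupp.single_eq_same]
  rfl

theorem Lpi_eq (F : FormalGroup S) (r : ℕ) :
    Lpi F P r = (ofCoeff fun d : Unit →₀ ℕ =>
      toRat _ (algebraMap (Rpi P) (SpTensor S P r) (pDivPi P)) * ((1 / p : ℚ) •
        (toRat _ (algebraMap (Rpi P) (SpTensor S P r) (piR P)) ^ d.degree *
          ((1 / (d ()) : ℚ) • toRat _ (inclTensor S P r (phiSp p S r
            (diffCoeff F (d () - 1)))))))).subst
      fun j => (MvPolynomial.map ((toRat (SpTensor S P r)).comp
        (algebraMap (Rpi P) (SpTensor S P r))) (subPiT P r (phiQuot (basePi P) r r j)) :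
          MvPowerSeries (Unit × Fin r) (RatTensor (SpTensor S P r))) := by
  have hQ : ∀ j : Unit, MvPolynomial.constantCoeff (MvPolynomial.map
      ((toRat (SpTensor S P r)).comp (algebraMap (Rpi P) (SpTensor S P r)))
        (subPiT P r (phiQuot (basePi P) r r j))) = 0 := fun j => by
    rw [MvPolynomial.constantCoeff_map, constantCoeff_subPiT, constantCoeff_phiQuot, map_zero]
  have hinc : (ratMap (inclTensor S P r)).comp
      ((toRat (Sp p S r)).comp (algebraMap (Rp p) (Sp p S r)))
      = ((toRat (SpTensor S P r)).comp (algebraMap (Rpi P) (SpTensor S P r))).comp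
        (algebraMap (Rp p) (Rpi P)) := by
    refine RingHom.ext fun c => ?_
    rw [RingHom.comp_apply, RingHom.comp_apply, ratMap_toRat, inclTensor_algebraMap]
    rfl
  -- The outer factors p/π and 1/p are moved into the coefficients; `subst_scaled` below does the
  -- same with the π^n coming from (π Q_r)^n.
  refine Eq.trans ?_ (C_mul_smul_subst hQ _ _ _)
  rw [Lpi, Lp, map_ratMap_smul]
  congr 2
  refine Eq.trans ?_ (subst_scaled (w' := fun j : Unit => MvPolynomial.map
    ((ratMap (inclTensor S P r)).comp ((toRat (Sp p S r)).comp (algebraMap (Rp p) (Sp p S r))))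
      (setZeroPoly r ((Phi (baseP p) (baseP p).ϖ)^[r] (MvPolynomial.X (j, 0))))) hQ
        (fun j => ?_) _)
  · rw [formalLog_map]
    refine (map_setZero_subst r (w := fun j : Unit =>
      (Phi (baseP p) (baseP p).ϖ)^[r] (MvPolynomial.X (j, 0)))
      (fun j => constantCoeff_Phi_iterate_X (baseP p) _ _ _)
      ((toRat (Sp p S r)).comp (algebraMap (Rp p) (Sp p S r)))
      (ratMap (inclTensor S P r)) _).trans ?_
    simp only [map_rat_smul, ratMap_toRat]
  · rw [hinc, ← MvPolynomial.map_map, ← C_mul_subPiT_phiQuot P le_rfl, map_mul, MvPolynomial.map_C]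
    rfl

/-- Here `c n` is π^{n-1}/n. The value `c 0 = 0` matches the vanishing constant coefficient of the
logarithm. -/
theorem exists_divided_powers (hE : P.poly.natDegree ≤ p - 1) :
    ∃ c : ℕ → Rpi P, c 0 = 0 ∧ (∀ n, n ≠ 0 → n * c n = piR P ^ (n - 1)) ∧
      ∀ m, ∃ N, ∀ n, N < n → (p : Rpi P) ^ m ∣ c n := by
  have h : ∀ n : ℕ, ∃ c : Rpi P, (n = 0 → c = 0) ∧ (n ≠ 0 → n * c = piR P ^ (n - 1)) := by
    intro n
    rcases eq_or_ne n 0 with rfl | hn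
    · exact ⟨0, by simp, by simp⟩
    · obtain ⟨c, hc⟩ := exists_mul_eq_piR_pow P hE (M := 0) hn (by omega)
      exact ⟨c, by simp [hn], fun _ => by simpa using hc⟩
  choose c h0 hc using h
  refine ⟨c, h0 0 rfl, hc, fun m => ⟨2 * m * (p - 1), fun n hn => ?_⟩⟩
  have hn0 : n ≠ 0 := by omega
  obtain ⟨c', hc'⟩ := exists_mul_eq_piR_pow P hE hn0 hn
  -- R_π is a domain and n c(n) = π^{n-1} ≠ 0, so n can be cancelled. This identifies the chosen `c
  -- n` with the quotient p^m c' known to be divisible.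
  have hne : (n : Rpi P) ≠ 0 := by
    intro h
    have := hc n hn0
    rw [h, zero_mul] at this
    exact pow_ne_zero _ (piR_ne_zero P) this.symm
  exact ⟨c', mul_left_cancel₀ hne ((hc n hn0).trans hc'.symm)⟩

/-- `D` need not be a domain, so π cannot be cancelled there. The identity (p/π) π^n = p · n · c is
proved in R_π and transported by `κ`; then p and n are inverted in the ℚ-algebra `D`. -/
theorem map_divided_power {D : Type*} [CommRing D] [Algebra ℚ D] (κ : Rpi P →+* D) {n : ℕ}
    {c : Rpi P} (h0 : n = 0 → c = 0) (hc : n ≠ 0 → n * c = piR P ^ (n - 1)) (t : D) :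
    κ (pDivPi P) * ((1 / p : ℚ) • (κ (piR P) ^ n * ((1 / n : ℚ) • t))) = κ c * t := by
  rcases eq_or_ne n 0 with rfl | hn
  · simp [h0 rfl]
  have hp : (p : ℚ) ≠ 0 := Nat.cast_ne_zero.2 (Fact.out : p.Prime).ne_zero
  have hn' : (n : ℚ) ≠ 0 := Nat.cast_ne_zero.2 hn
  obtain ⟨k, rfl⟩ := Nat.exists_eq_add_one_of_ne_zero hn
  have h1 : pDivPi P * piR P ^ (k + 1) = p * ((k + 1 : ℕ) * c) := by
    rw [hc hn, Nat.add_sub_cancel, ← piR_mul_pDivPi, pow_succ]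
    ring
  have h2 := congrArg κ h1
  rw [map_mul, map_pow, map_mul, map_mul, map_natCast, map_natCast] at h2
  have e1 : algebraMap ℚ D (1 / p) * p = 1 := by
    rw [← map_natCast (algebraMap ℚ D), ← map_mul, one_div_mul_cancel hp, map_one]
  have e2 : algebraMap ℚ D (1 / (k + 1 : ℕ)) * (k + 1 : ℕ) = 1 := by
    rw [← map_natCast (algebraMap ℚ D), ← map_mul, one_div_mul_cancel hn', map_one]
  rw [Algebra.smul_def, Algebra.smul_def]
  calc _ = algebraMap ℚ D (1 / p) * algebraMap ℚ D (1 / (k + 1 : ℕ)) *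
        (κ (pDivPi P) * κ (piR P) ^ (k + 1)) * t := by ring
    _ = (algebraMap ℚ D (1 / p) * p) * (algebraMap ℚ D (1 / (k + 1 : ℕ)) * (k + 1 : ℕ)) *
        κ c * t := by rw [h2]; ring
    _ = κ c * t := by rw [e1, e2, one_mul, one_mul]

theorem exists_natHom_eq_Lpi (F : FormalGroup S) (r : ℕ)
    (h : 1 / ((p : ℚ) - 1) ≤ vp P (piR P)) :
    ∃ G : MvPowerSeries (Unit × Fin r) (Spi S P r), IsRestricted p G ∧
      (natHom S P r Unit G).map (toRat (SpTensor S P r)) = Lpi F P r := by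
  obtain ⟨c, h0, hc, hN⟩ := exists_divided_powers P (natDegree_le_of_vp P h)
  have hdeg : ∀ d : Unit →₀ ℕ, d.degree = d () := fun d => by
    simp [Finsupp.degree_eq_sum]
  refine ⟨_, isRestricted_subst_phiQuot S P (i := r) (c := fun d => c (d ()))
    (fun m => ?_) fun d => toSpi S P r ((Phi (basePi P) (basePi P).ϖ)^[r]
      (MvPolynomial.X (diffCoeff F (d () - 1), 0))), ?_⟩
  · obtain ⟨N, hN⟩ := hN m
    exact ⟨N, fun d hd => hN _ (hdeg d ▸ hd)⟩
  rw [natHom_subst_phiQuot S P le_rfl, Lpi_eq]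
  refine (map_subst_coe (fun j => ?_) _).trans ?_
  · rw [MvPolynomial.constantCoeff_map, constantCoeff_subPiT, constantCoeff_phiQuot, map_zero]
  rw [map_ofCoeff]
  simp only [MvPolynomial.map_map]
  congr 2
  funext d
  have := map_divided_power P ((toRat (SpTensor S P r)).comp (algebraMap (Rpi P) (SpTensor S P r)))
    (n := d ()) (c := c (d ())) (fun h => h ▸ h0) (hc _)
    (toRat _ (inclTensor S P r (phiSp p S r (diffCoeff F (d () - 1)))))
  rw [hdeg]
  refine Eq.trans ?_ this.symm
  rw [map_mul, phiSp_apply]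
  rfl

end Logarithm

end PiJet

end

theorem proposition2p10 (p : ℕ) [Fact p.Prime] (hp : 5 ≤ p) (P : PiJet.EisensteinPoly p)
    (S : Type*) [CommRing S] [Algebra (PiJet.Rp p) S] [Algebra.Smooth (PiJet.Rp p) S]
    (F : FormalGroup S) (r : ℕ) (hr : 1 ≤ r) :
    (∃ n : ℕ, 1 ≤ n ∧
      ∃ G : MvPowerSeries (Fin 2 × Fin r) (PiJet.Spi S P r), PiJet.IsRestricted p G ∧
        PiJet.natHom S P r (Fin 2) G =
          (p : MvPowerSeries (Fin 2 × Fin r) (PiJet.SpTensor S P r)) ^ n *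
            (PiJet.jetSeries p r F.toPowerSeries).map (PiJet.inclTensor S P r)) ∧
    (1 / ((p : ℚ) - 1) ≤ PiJet.vp P (PiJet.piR P) →
      ∃ G : MvPowerSeries (Unit × Fin r) (PiJet.Spi S P r), PiJet.IsRestricted p G ∧
        (PiJet.natHom S P r Unit G).map (PiJet.toRat (PiJet.SpTensor S P r)) =
          PiJet.Lpi F P r) := by
  exact ⟨PiJet.exists_natHom_eq_pow_mul_jetSeries S P r F.toPowerSeries,
    PiJet.exists_natHom_eq_Lpi P F r⟩
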